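/- **Setting.** Let $d,N,M,K\ge 1$ be integers, let $x_0,\dots,x_{N-1}\in\mathbb R^d$ be data points with labels $y_i\in\{-1,+1\}$, and let the index set $I=\{0,\dots,N-1\}$ be a disjoint union $I=\biguplus_{m=0}^{M-1} I_m$ (the data of $M$ tasks). Let $\ell:\mathbb R\to\mathbb R$ be a differentiable loss and $\mathcal L_m(w)=\sum_{i\in I_m}\ell(y_i x_i^\top w)$. Let $m_0,m_1,\dots$ be i.i.d. random variables, uniformly distributed on $\{0,\dots,M-1\}$. For $\eta>0$ and any initial point $w^{(0)}_0\in\mathbb R^d$, sequential GD is $$w^{(t)}_{k+1}=w^{(t)}_k-\eta\nabla\mathcal L_{m_t}(w^{(t)}_k)\quad(0\le k\le K-1),\qquad w^{(t+1)}_0=w^{(t)}_K .$$ **Assumptions.** 1. (Joint separability) There is $w\in\mathbb R^d$ with $y_i x_i^\top w>0$ for all $i\in I$. Let $\hat w$ be the joint max-margin solution, i.e. the unique minimizer of $\|w\|^2$ subject to $y_i x_i^\top w\ge 1$ for all $i\in I$. Put $\phi=\min_{i\in I} y_i x_i^\top\hat w/\|\hat w\|$, and let $S=\{i\in I: y_i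 x_i^\top\hat w/\|\hat w\|=\phi\}$ be the set of support vectors. 2. (Non-degeneracy) There is a unique family $(\alpha_i)_{i\in S}$ of positive reals with $\hat w=\sum_{i\in S}\alpha_i y_i x_i$. 3. (Loss shape) $\ell>0$; $\ell$ is $\beta$-smooth, i.e. $|\ell'(u)-\ell'(v)|\le\beta|u-v|$ for all $u,v$; $\ell$ is monotonically decreasing to zero, in the sense that $\ell'(u)<0$ for all $u$ and $\lim_{u\to+\infty}\ell(u)=0$; and $\limsup_{u\to-\infty}\ell'(u)<0$ (in the extended reals). 4. (Tight exponential tail) There are $\mu_+,\mu_-,\bar u>0$ such that for all $u>\bar u$, $(1-e^{-\mu_- u})e^{-u}\le-\ell'(u)\le(1+e^{-\mu_+ u})e^{-u}$. 5. (Learning rate) $0<\eta<\dfrac{2\phi^2}{\beta\,\sigma_{\max}^4}$, where $\sigma_{\max}=\sqrt{\lambda_{\max}(XX^\top)}$ and $X\in\mathbb R^{d\times N}$ is the matrix with columns $x_i$. **Conclusion.** With probability 1, $$w^{(t)}_k=\ln(t)\,\hat w+\rho^{(t)}_k\qquad\text{for all } t\ge 1,\ 0\le k\le K-1,$$ where $\|\rho^{(t)}_k\|$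 is bounded uniformly in $t\ge1$ and $0\le k\le K-1$ (the bound may depend on the realization of the task order). Consequently, with probability 1, for every $0\le k\le K-1$, $$\lim_{t\to\infty}\frac{w^{(t)}_k}{\|w^{(t)}_k\|}=\frac{\hat w}{\|\hat w\|}.$$ -/

import Mathlib

open MeasureTheory ProbabilityTheory Filter Topology

noncomputable section

namespace ContinualGD

/-- Joint separability of the data `x` (points of `ℝᵈ`) with labels `y`. -/
def JointlySeparable {d N : ℕ} (x : Fin N → EuclideanSpace ℝ (Fin d)) (y : Fin N → ℝ) : Prop :=
  ∃ w : EuclideanSpace ℝ (Fin d), ∀ i, 0 < y i * inner ℝ (x i) w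

/-- `v` solves: minimize `‖w‖²` subject to `yᵢ xᵢᵀ w ≥ 1` for all `i`. -/
def IsMaxMarginSolution {d N : ℕ} (x : Fin N → EuclideanSpace ℝ (Fin d)) (y : Fin N → ℝ)
    (v : EuclideanSpace ℝ (Fin d)) : Prop :=
  (∀ i, 1 ≤ y i * inner ℝ (x i) v) ∧
    ∀ w : EuclideanSpace ℝ (Fin d), (∀ i, 1 ≤ y i * inner ℝ (x i) w) → ‖v‖ ^ 2 ≤ ‖w‖ ^ 2

theorem existsUnique_isMaxMarginSolution {d N : ℕ} {x : Fin N → EuclideanSpace ℝ (Fin d)}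
    {y : Fin N → ℝ} (h : JointlySeparable x y) : ∃! v, IsMaxMarginSolution x y v := by
  have hne : {w : EuclideanSpace ℝ (Fin d) | ∀ i, 1 ≤ y i * inner ℝ (x i) w}.Nonempty := by
    obtain ⟨w, hw⟩ := h
    refine ⟨(∑ j, (y j * inner ℝ (x j) w)⁻¹) • w, fun i => ?_⟩
    rw [inner_smul_right]
    have h1 : (y i * inner ℝ (x i) w)⁻¹ ≤ ∑ j, (y j * inner ℝ (x j) w)⁻¹ :=
      Finset.single_le_sum (f := fun j => (y j * inner ℝ (x j) w)⁻¹)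
        (fun j _ => (inv_pos.2 (hw j)).le) (Finset.mem_univ i)
    have h2 := mul_le_mul_of_nonneg_right h1 (hw i).le
    rw [inv_mul_cancel₀ (hw i).ne'] at h2
    linarith
  have hcl : IsClosed {w : EuclideanSpace ℝ (Fin d) | ∀ i, 1 ≤ y i * inner ℝ (x i) w} := by
    rw [Set.ofPred_forall]
    exact isClosed_iInter fun i => isClosed_le continuous_const (by fun_prop)
  obtain ⟨v, hv, hmin⟩ := hcl.exists_infDist_eq_dist hne 0
  have hle : ∀ w : EuclideanSpace ℝ (Fin d), (∀ i, 1 ≤ y i * inner ℝ (x i) w) → ‖v‖ ≤ ‖w‖ := by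
    intro w hw
    have := Metric.infDist_le_dist_of_mem (x := (0 : EuclideanSpace ℝ (Fin d))) (y := w) (show w ∈ {w | ∀ i, 1 ≤ y i * inner ℝ (x i) w} from hw)
    rwa [hmin, dist_zero_left, dist_zero_left] at this
  refine ⟨v, ⟨hv, fun w hw => pow_le_pow_left₀ (norm_nonneg v) (hle w hw) 2⟩, ?_⟩
  rintro u ⟨hu, hu2⟩
  have h1 := hu2 v hv
  have h2 : ‖v‖ ≤ ‖(1 / 2 : ℝ) • (u + v)‖ := by
    refine hle _ fun i => ?_
    have a := hu i
    have b := hv i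
    rw [inner_smul_right, inner_add_right]
    linarith
  rw [norm_smul, Real.norm_of_nonneg (by norm_num)] at h2
  have h3 := parallelogram_law_with_norm ℝ u v
  have h4 : ‖u - v‖ = 0 := by
    have := norm_nonneg v
    nlinarith [norm_nonneg (u - v), norm_nonneg (u + v)]
  exact sub_eq_zero.1 (norm_eq_zero.1 h4)

/-- The joint `ℓ²` max-margin solution `ŵ`. -/
def maxMarginSolution {d N : ℕ} {x : Fin N → EuclideanSpace ℝ (Fin d)} {y : Fin N → ℝ}
    (h : JointlySeparable x y) : EuclideanSpace ℝ (Fin d) :=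
  (existsUnique_isMaxMarginSolution h).choose

theorem isMaxMarginSolution_maxMarginSolution {d N : ℕ} {x : Fin N → EuclideanSpace ℝ (Fin d)}
    {y : Fin N → ℝ} (h : JointlySeparable x y) :
    IsMaxMarginSolution x y (maxMarginSolution h) :=
  (existsUnique_isMaxMarginSolution h).choose_spec.1

/-- The maximum margin `φ = minᵢ yᵢ xᵢᵀ ŵ / ‖ŵ‖`. -/
def maxMargin {d N : ℕ} {x : Fin N → EuclideanSpace ℝ (Fin d)} {y : Fin N → ℝ}
    (h : JointlySeparable x y) : ℝ :=
  ⨅ i, y i * inner ℝ (x i) (maxMarginSolution h) / ‖maxMarginSolution h‖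

open Classical in
/-- The index set `S` of support vectors: those attaining the minimum in `φ`. -/
def supportVectors {d N : ℕ} {x : Fin N → EuclideanSpace ℝ (Fin d)} {y : Fin N → ℝ}
    (h : JointlySeparable x y) : Finset (Fin N) :=
  Finset.univ.filter fun i =>
    y i * inner ℝ (x i) (maxMarginSolution h) / ‖maxMarginSolution h‖ = maxMargin h

/-- Non-degeneracy: there are unique coefficients `αᵢ > 0`, `i ∈ S` (extended by `0` off `S`),
with `ŵ = ∑_{i ∈ S} αᵢ yᵢ xᵢ`. -/
def NonDegenerate {d N : ℕ} {x : Fin N → EuclideanSpace ℝ (Fin d)} {y : Fin N → ℝ}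
    (h : JointlySeparable x y) : Prop :=
  ∃! α : Fin N → ℝ, (∀ i ∈ supportVectors h, 0 < α i) ∧ (∀ i, i ∉ supportVectors h → α i = 0) ∧
    maxMarginSolution h = ∑ i ∈ supportVectors h, (α i * y i) • x i

/-- The joint data matrix, whose columns are the data points. -/
def dataMatrix {d N : ℕ} (x : Fin N → EuclideanSpace ℝ (Fin d)) : Matrix (Fin d) (Fin N) ℝ :=
  Matrix.of fun j i => x i j

/-- `σ_max = √(λ_max (X Xᵀ))`. -/
def sigmaMax {d N : ℕ} (x : Fin N → EuclideanSpace ℝ (Fin d)) : ℝ :=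
  Real.sqrt (sSup (spectrum ℝ (dataMatrix x * (dataMatrix x).transpose)))

/-- The loss `ℓ` is positive, `β`-smooth, decreases to zero (with negative derivative), and
`limsup_{u → -∞} ℓ'(u) < 0`. The limsup is taken in the extended reals, as `ℓ'` may be
unbounded below. -/
structure LossShape (ℓ : ℝ → ℝ) (β : ℝ) : Prop where
  pos : ∀ u, 0 < ℓ u
  differentiable : Differentiable ℝ ℓ
  smooth : ∀ u v, |deriv ℓ u - deriv ℓ v| ≤ β * |u - v|
  deriv_neg : ∀ u, deriv ℓ u < 0
  tendsto_zero : Tendsto ℓ atTop (𝓝 0)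
  limsup_deriv_neg : limsup (fun u => ((deriv ℓ u : ℝ) : EReal)) atBot < 0

/-- The negative loss derivative has a tight exponential tail. -/
def TightExpTail (ℓ : ℝ → ℝ) : Prop :=
  ∃ μp μm ubar : ℝ, 0 < μp ∧ 0 < μm ∧ 0 < ubar ∧ ∀ u, ubar < u →
    (1 - Real.exp (-μm * u)) * Real.exp (-u) ≤ -deriv ℓ u ∧
      -deriv ℓ u ≤ (1 + Real.exp (-μp * u)) * Real.exp (-u)

/-- The training loss over the data with indices in `I`. -/
def taskLoss {d N : ℕ} (x : Fin N → EuclideanSpace ℝ (Fin d)) (y : Fin N → ℝ) (ℓ : ℝ → ℝ)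
    (I : Finset (Fin N)) (w : EuclideanSpace ℝ (Fin d)) : ℝ :=
  ∑ i ∈ I, ℓ (y i * inner ℝ (x i) w)

/-- `k` gradient descent steps on `F` with learning rate `η`, started at `w`. -/
def gdIterate {d : ℕ} (η : ℝ) (F : EuclideanSpace ℝ (Fin d) → ℝ)
    (w : EuclideanSpace ℝ (Fin d)) : ℕ → EuclideanSpace ℝ (Fin d)
  | 0 => w
  | k + 1 => gdIterate η F w k - η • gradient F (gdIterate η F w k)

/-- The first iterate `w₀⁽ᵗ⁾` of stage `t`, when the loss of stage `s` is `F s` and each stage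
consists of `K` gradient descent steps. -/
def stageStart {d : ℕ} (η : ℝ) (K : ℕ) (F : ℕ → EuclideanSpace ℝ (Fin d) → ℝ)
    (w₀ : EuclideanSpace ℝ (Fin d)) : ℕ → EuclideanSpace ℝ (Fin d)
  | 0 => w₀
  | t + 1 => gdIterate η (F t) (stageStart η K F w₀ t) K

/-- The sequential GD iterate `w_k⁽ᵗ⁾`. -/
def seqGD {d : ℕ} (η : ℝ) (K : ℕ) (F : ℕ → EuclideanSpace ℝ (Fin d) → ℝ)
    (w₀ : EuclideanSpace ℝ (Fin d)) (t k : ℕ) : EuclideanSpace ℝ (Fin d) :=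
  gdIterate η (F t) (stageStart η K F w₀ t) k

/-- The tasks `m 0, m 1, …` are independent and uniform on the `M` tasks. -/
structure IsUniformTaskOrder {Ω : Type*} [MeasurableSpace Ω] (P : Measure Ω) {M : ℕ}
    (m : ℕ → Ω → Fin M) : Prop where
  measurable : ∀ t, Measurable (m t)
  indep : iIndepFun m P
  uniform : ∀ t j, P {ω | m t ω = j} = (M : ENNReal)⁻¹

end ContinualGD

end

/-!
The proof compares the iterates with an explicit path. Write `vᵢ = yᵢ xᵢ`, `uᵢ = ⟪vᵢ, w⟫` and
`f = -η ℓ'`, so that a gradient step on task `j` adds `∑_{i ∈ I j} f(uᵢ) vᵢ` to `w`. The comparison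
path `G` moves, in each step of stage `t`, by `∑_{i ∈ I j} (aᵢ / t) vᵢ` with `aᵢ = M αᵢ / K` on the
support vectors and `aᵢ = 0` elsewhere. As every task is drawn with probability `1 / M` and
`ŵ = ∑ αᵢ vᵢ`, this path is `log t • ŵ + w̃ + nₜ + O(1/t)`, with a constant `w̃` and a fluctuation
`nₜ` that solves a recursion driven by the centred task order.

*Fluctuations.* The centred visit counts `R` of a task are random walks with `E Rₜ² = O(t)`, so
`∑ Rₜ² / t^{9/4} < ∞` almost surely (`IsUniformTaskOrder.ae_summable`). Summation by parts then
yields, for every such task order, a bounded choice of `nₜ` with `∑ ‖nₜ‖ / t < ∞`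
(`exists_corrector`, `exists_taskOrder_corrector`). The rest of the proof is pathwise.

*Drift.* Let `r = w - G`. One step changes `‖r‖²` by at most the sum over `i` of
`2 (f(uᵢ) - qᵢ) (uᵢ - gᵢ) + σ_max² (f(uᵢ) - qᵢ)²` with `gᵢ = ⟪vᵢ, G⟫` and `qᵢ = aᵢ / t`. Non-degeneracy
makes the support vectors linearly independent, so `w̃` can be chosen with `f(gᵢ) ≈ qᵢ`. By the
exponential tail, `f(uᵢ) - qᵢ` and `uᵢ - gᵢ` then have opposite signs except where the product is at
most of order `(‖nₜ‖ + t^{-μ} + t^{-1}) / t`. When they do, the first-order term absorbs the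
second-order one up to `O(t⁻²)`: `f` is `η β`-Lipschitz, and the learning rate condition gives `η β σ_max² < 2`
because `φ ≤ σ_max` (`TailMap.drift_le`). Neither convexity of `ℓ` nor prior convergence of the loss is
needed, as the lower bound on `-ℓ'` near `-∞` covers misclassified points. For non-support points
`⟪vᵢ, ŵ⟫ > 1` makes the error `t^{-⟪vᵢ, ŵ⟫}`, again summable. So `‖r‖²` has summable upward
increments and stays bounded (`TailMap.exists_norm_sub_log_smul_le`), and so does `w - log t • ŵ`.
-/

namespace ContinualGD

/-! ### The scalar descent inequality -/

/-- The step size map `f = -η ℓ'` seen along one data point, with an exponential tail of rate `1`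
and leading constant `η`, bounded away from `0` on the left, and `L`-Lipschitz. -/
structure TailMap (f : ℝ → ℝ) (η L μ ubar δ : ℝ) : Prop where
  eta_pos : 0 < η
  mu_pos : 0 < μ
  ubar_pos : 0 < ubar
  delta_pos : 0 < δ
  pos : ∀ u, 0 < f u
  lipschitz : ∀ u v, |f u - f v| ≤ L * |u - v|
  lower : ∀ u, ubar < u → η * ((1 - Real.exp (-μ * u)) * Real.exp (-u)) ≤ f u
  upper : ∀ u, ubar < u → f u ≤ η * ((1 + Real.exp (-μ * u)) * Real.exp (-u))
  left : ∀ u, u ≤ ubar → δ ≤ f u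

variable {f : ℝ → ℝ} {η L μ ubar δ : ℝ}

/-- One-step drift of the squared distance to a target moving by `q`, at a point `u` with target
value `g`. It is controlled by `f g + q` when `f u - q` pushes `u` towards `g`, because of the Lipschitz
bound with `s L < 2`; the two cases where it pushes away from `g` are left to `hlow` and `hupp`. -/
theorem TailMap.drift_le (hf : TailMap f η L μ ubar δ) {s : ℝ} (hs : 0 ≤ s) (hL : 0 ≤ L)
    (hsL : s * L < 2) {q g u E : ℝ} (hq : 0 ≤ q) (hE : 0 ≤ E)
    (hlow : u < g → f u < q → 2 * q * (g - u) ≤ E)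
    (hupp : g ≤ u → q < f u → 2 * f u * (u - g) + s * f u ^ 2 ≤ E) :
    2 * (f u - q) * (u - g) + s * (f u - q) ^ 2 ≤
      E + ((L * s / (2 - s * L) + 1) * s + s) * (f g + q) ^ 2 := by
  have hκ : 0 < 2 - s * L := by linarith
  have hc : 0 ≤ L * s / (2 - s * L) := by positivity
  have hfu := hf.pos u
  have hfg := hf.pos g
  set c := L * s / (2 - s * L) with hcdef
  have hsq : q ^ 2 ≤ (f g + q) ^ 2 := by nlinarith
  have h0 : 0 ≤ (c + 1) * s * (f g + q) ^ 2 := by positivity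
  have h1 : s * q ^ 2 ≤ s * (f g + q) ^ 2 := mul_le_mul_of_nonneg_left hsq hs
  have h2 : 0 ≤ s * (f g + q) ^ 2 := by positivity
  rcases lt_or_ge u g with hug | hug
  · rcases lt_or_ge (f u) q with hD | hD
    · have ha := hlow hug hD
      have h3 : (f u - q) ^ 2 ≤ q ^ 2 := by nlinarith
      have h4 : s * (f u - q) ^ 2 ≤ s * q ^ 2 := mul_le_mul_of_nonneg_left h3 hs
      have h5 : 0 ≤ f u * (g - u) := mul_nonneg hfu.le (by linarith)
      nlinarith
    · have hlip := hf.lipschitz u g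
      rw [abs_sub_comm u g, abs_of_pos (sub_pos.2 hug)] at hlip
      have h3 := (le_abs_self _).trans hlip
      have hDle : f u - q ≤ L * (g - u) + (f g + q) := by linarith
      by_cases hcase : s * (f g + q) ≤ (2 - s * L) * (g - u)
      · have h4 : (f u - q) * (-2 * (g - u) + s * (f u - q)) ≤ 0 := by
          refine mul_nonpos_of_nonneg_of_nonpos (by linarith) ?_
          have := mul_le_mul_of_nonneg_left hDle hs
          nlinarith
        nlinarith
      · push Not at hcase
        have hδ : L * (g - u) ≤ c * (f g + q) := by
          have : g - u ≤ s * (f g + q) / (2 - s * L) := by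
            rw [le_div_iff₀ hκ]; linarith
          calc L * (g - u) ≤ L * (s * (f g + q) / (2 - s * L)) :=
                mul_le_mul_of_nonneg_left this hL
            _ = c * (f g + q) := by rw [hcdef]; ring
        have hD2 : f u - q ≤ (c + 1) * (f g + q) := by linarith
        have h4 : (f u - q) * (-2 * (g - u) + s * (f u - q)) ≤
            (f u - q) * (s * (f g + q)) := by
          refine mul_le_mul_of_nonneg_left ?_ (by linarith)
          have := mul_le_mul_of_nonneg_left hDle hs
          nlinarith
        have h5 : (f u - q) * (s * (f g + q)) ≤ (c + 1) * (f g + q) * (s * (f g + q)) :=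
          mul_le_mul_of_nonneg_right hD2 (by positivity)
        nlinarith
  · rcases le_or_gt (f u) q with hD | hD
    · have h3 : (f u - q) ^ 2 ≤ q ^ 2 := by nlinarith
      have h4 : s * (f u - q) ^ 2 ≤ s * q ^ 2 := mul_le_mul_of_nonneg_left h3 hs
      have h5 : (f u - q) * (u - g) ≤ 0 :=
        mul_nonpos_of_nonpos_of_nonneg (by linarith) (by linarith)
      nlinarith
    · have ha := hupp hug hD
      have h3 : (f u - q) ^ 2 ≤ f u ^ 2 := by nlinarith
      have h4 : s * (f u - q) ^ 2 ≤ s * f u ^ 2 := mul_le_mul_of_nonneg_left h3 hs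
      have h5 : 0 ≤ q * (u - g) := mul_nonneg hq (by linarith)
      nlinarith

theorem TailMap.le_two_mul_exp (hf : TailMap f η L μ ubar δ) {u : ℝ} (hu : ubar < u) :
    f u ≤ 2 * η * Real.exp (-u) := by
  have h1 : Real.exp (-μ * u) ≤ 1 := by
    rw [Real.exp_le_one_iff]; nlinarith [hf.mu_pos, hf.ubar_pos]
  have h2 := mul_le_mul_of_nonneg_right h1 (Real.exp_pos (-u)).le
  nlinarith [hf.upper u hu, hf.eta_pos]

/-- Inverting the lower tail bound: a small value `f u` forces `u` not to be much below `p`. -/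
theorem TailMap.sub_le_of_lt (hf : TailMap f η L μ ubar δ) {u p : ℝ} (hu : ubar < u)
    (h : f u < η * Real.exp (-p)) :
    p - u ≤ -Real.log (1 - Real.exp (-μ * ubar)) ∧
      p - u ≤ Real.exp (-μ * u) / (1 - Real.exp (-μ * ubar)) := by
  have hμ := hf.mu_pos
  have hlow := hf.lower u hu
  set y := Real.exp (-μ * u) with hy
  set c0 := 1 - Real.exp (-μ * ubar) with hc0
  have hc0pos : 0 < c0 := by
    have : Real.exp (-μ * ubar) < 1 := by
      rw [Real.exp_lt_one_iff]; linarith [mul_pos hμ hf.ubar_pos]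
    linarith
  have hyc : c0 ≤ 1 - y := by
    have : y ≤ Real.exp (-μ * ubar) :=
      Real.exp_le_exp.2 (by linarith [mul_lt_mul_of_pos_left hu hμ])
    linarith
  have hlt : (1 - y) * Real.exp (-u) < Real.exp (-p) :=
    lt_of_mul_lt_mul_left (hlow.trans_lt h) hf.eta_pos.le
  have hypos : 0 < 1 - y := by linarith
  have hlog : Real.log (1 - y) - u < -p := by
    have := Real.log_lt_log (by positivity) hlt
    rwa [Real.log_mul hypos.ne' (Real.exp_pos _).ne', Real.log_exp, Real.log_exp] at this
  have hlogc0 : Real.log c0 ≤ Real.log (1 - y) := Real.log_le_log hc0pos hyc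
  have hl := Real.one_sub_inv_le_log_of_pos hypos
  have hinv : (1 - y)⁻¹ - 1 ≤ y / c0 := by
    have : (1 - y)⁻¹ - 1 = y / (1 - y) := by field_simp; ring
    rw [this]
    exact div_le_div_of_nonneg_left (Real.exp_pos _).le hc0pos hyc
  constructor <;> linarith

/-- Inverting the upper tail bound: a large value `f u` forces `u` not to be much above `p`. -/
theorem TailMap.sub_le_of_gt (hf : TailMap f η L μ ubar δ) {u p : ℝ} (hu : ubar < u)
    (h : η * Real.exp (-p) < f u) : u - p ≤ Real.exp (-μ * u) := by
  have hup := hf.upper u hu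
  set y := Real.exp (-μ * u) with hy
  have hypos : 0 < y := Real.exp_pos _
  have hlt : Real.exp (-p) < (1 + y) * Real.exp (-u) :=
    lt_of_mul_lt_mul_left (h.trans_le hup) hf.eta_pos.le
  have hlog : -p < Real.log (1 + y) - u := by
    have := Real.log_lt_log (by positivity) hlt
    rwa [Real.log_mul (by positivity) (Real.exp_pos _).ne', Real.log_exp, Real.log_exp] at this
  have hl : Real.log (1 + y) ≤ y := by
    have := Real.log_le_sub_one_of_pos (show 0 < 1 + y by positivity)
    linarith
  linarith

/-- Drift bound at a support vector: the target `g = τ + c + n` is where `f` takes about the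
value `q = η e^{-c} e^{-τ}`, up to the relative error `e^{n}`. -/
theorem TailMap.exists_drift_le_support (hf : TailMap f η L μ ubar δ) {s : ℝ} (hs : 0 ≤ s)
    (hL : 0 ≤ L) (hsL : s * L < 2) (c B : ℝ) :
    ∃ C T : ℝ, 0 ≤ C ∧ ∀ τ, T ≤ τ → ∀ n, |n| ≤ B → ∀ u,
      2 * (f u - η * Real.exp (-c) * Real.exp (-τ)) * (u - (τ + c + n)) +
        s * (f u - η * Real.exp (-c) * Real.exp (-τ)) ^ 2 ≤
      C * Real.exp (-τ) * (|n| + Real.exp (-μ * τ) + Real.exp (-τ)) := by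
  have hη := hf.eta_pos
  have hμ := hf.mu_pos
  have hub := hf.ubar_pos
  have hδ := hf.delta_pos
  set a := η * Real.exp (-c) with ha
  have hapos : 0 < a := by positivity
  set c0 := 1 - Real.exp (-μ * ubar) with hc0
  have hc0pos : 0 < c0 := by
    have : Real.exp (-μ * ubar) < 1 := by rw [Real.exp_lt_one_iff]; nlinarith
    linarith
  -- `Z₁`, `Z₂` bound `e^{-μ u}` by `e^{-μ τ}` in the two bad cases of `drift_le`.
  set Z₁ := Real.exp (-μ * (c + Real.log c0)) / c0 with hZ₁
  set Z₂ := Real.exp (-μ * (c - B)) with hZ₂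
  set F := 2 * a * Real.exp B with hF
  have hZ₁pos : 0 < Z₁ := by positivity
  have hZ₂pos : 0 < Z₂ := by positivity
  have hFpos : 0 < F := by positivity
  set A := (L * s / (2 - s * L) + 1) * s + s with hA
  have hA0 : 0 ≤ A := by
    have : 0 < 2 - s * L := by linarith
    positivity
  refine ⟨2 * a * (1 + Z₁) + (2 * F * (1 + Z₂) + s * F ^ 2) + A * (F + a) ^ 2,
    max (ubar + 1 - c + B) (Real.log (a / δ) + 1), by positivity, ?_⟩
  intro τ hτ n hn u
  have hτ1 : ubar + 1 - c + B ≤ τ := (le_max_left _ _).trans hτ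
  have hτ2 : Real.log (a / δ) + 1 ≤ τ := (le_max_right _ _).trans hτ
  obtain ⟨hn1, hn2⟩ := abs_le.1 hn
  set e := Real.exp (-τ) with he
  set z := Real.exp (-μ * τ) with hz
  have hepos : 0 < e := Real.exp_pos _
  have hzpos : 0 < z := Real.exp_pos _
  set g := τ + c + n with hg
  have hgub : ubar < g := by linarith
  -- `f ≤ F e` to the right of `g`
  have hfF : ∀ v, g ≤ v → f v ≤ F * e := by
    intro v hv
    refine (hf.le_two_mul_exp (hgub.trans_le hv)).trans ?_
    have : Real.exp (-v) ≤ Real.exp (-c + B + -τ) := Real.exp_le_exp.2 (by linarith)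
    rw [Real.exp_add, Real.exp_add] at this
    calc 2 * η * Real.exp (-v) ≤ 2 * η * (Real.exp (-c) * Real.exp B * Real.exp (-τ)) := by gcongr
      _ = F * e := by rw [hF, ha, he]; ring
  have haexp : a * e = η * Real.exp (-(g - n)) := by
    rw [ha, he, hg, mul_assoc, ← Real.exp_add]; congr 2; ring
  have key := hf.drift_le hs hL hsL (q := a * e) (g := g) (u := u)
    (E := 2 * a * e * (|n| + Z₁ * z) + (2 * F * e * (|n| + Z₂ * z) + s * (F * e) ^ 2))
    (by positivity) (by positivity) ?_ ?_
  · refine key.trans ?_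
    have h1 : (f g + a * e) ^ 2 ≤ ((F + a) * e) ^ 2 := by
      have := hfF g le_rfl
      have := hf.pos g
      exact pow_le_pow_left₀ (by positivity) (by linarith) 2
    have h2 := mul_le_mul_of_nonneg_left h1 hA0
    have h3 : 0 ≤ |n| := abs_nonneg n
    have : 2 * a * e * (|n| + Z₁ * z) + (2 * F * e * (|n| + Z₂ * z) + s * (F * e) ^ 2)
        + A * ((F + a) * e) ^ 2 ≤
        (2 * a * (1 + Z₁) + (2 * F * (1 + Z₂) + s * F ^ 2) + A * (F + a) ^ 2) * e *
          (|n| + z + e) := by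
      have e1 : 0 ≤ 2 * a * e * (Z₁ * |n| + z + (1 + Z₁) * e) := by positivity
      have e2 : 0 ≤ 2 * F * e * (Z₂ * |n| + z + (1 + Z₂) * e) := by positivity
      have e3 : 0 ≤ (s * F ^ 2 + A * (F + a) ^ 2) * e * (|n| + z) := by positivity
      linarith
    linarith
  · intro hug hD
    have hnonneg : 0 ≤ 2 * F * e * (|n| + Z₂ * z) + s * (F * e) ^ 2 := by positivity
    suffices h : g - u ≤ |n| + Z₁ * z by
      have := mul_le_mul_of_nonneg_left h (show 0 ≤ 2 * a * e by positivity)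
      linarith
    have hqδ : a * e < δ := by
      have h1 : e < Real.exp (-Real.log (a / δ)) := Real.exp_lt_exp.2 (by linarith)
      rw [Real.exp_neg, Real.exp_log (by positivity), inv_div, lt_div_iff₀ hapos] at h1
      linarith
    have hu : ubar < u := by
      by_contra h
      exact absurd (hf.left u (not_lt.1 h)) (by linarith)
    obtain ⟨h1, h2⟩ := hf.sub_le_of_lt hu (p := g - n) (by rw [← haexp]; exact hD)
    have hyz : Real.exp (-μ * u) / c0 ≤ Z₁ * z := by
      rw [hZ₁, hz, div_mul_eq_mul_div, ← Real.exp_add]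
      refine div_le_div_of_nonneg_right (Real.exp_le_exp.2 ?_) hc0pos.le
      have := mul_le_mul_of_nonneg_left (show τ + c + Real.log c0 ≤ u by linarith) hμ.le
      linarith
    linarith [le_abs_self n]
  · intro hug hD
    have hnonneg : 0 ≤ 2 * a * e * (|n| + Z₁ * z) := by positivity
    have hfu := hfF u hug
    have hfpos := hf.pos u
    have hsq : s * f u ^ 2 ≤ s * (F * e) ^ 2 :=
      mul_le_mul_of_nonneg_left (pow_le_pow_left₀ hfpos.le hfu 2) hs
    suffices h : u - g ≤ |n| + Z₂ * z by
      have h1 : f u * (u - g) ≤ F * e * (|n| + Z₂ * z) :=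
        mul_le_mul hfu h (by linarith) (by positivity)
      linarith
    have h1 := hf.sub_le_of_gt (hgub.trans_le hug) (p := g - n) (by rw [← haexp]; exact hD)
    have hyz : Real.exp (-μ * u) ≤ Z₂ * z := by
      rw [hZ₂, hz, ← Real.exp_add]
      refine Real.exp_le_exp.2 ?_
      have := mul_le_mul_of_nonneg_left (show τ + c - B ≤ u by linarith) hμ.le
      linarith
    linarith [neg_abs_le n]

/-- Drift bound away from the support vectors, where the target `g = θ τ + n` grows so fast that
`e^{-g}` is negligible against `e^{-τ}`. -/
theorem TailMap.exists_drift_le_nonsupport (hf : TailMap f η L μ ubar δ) {s : ℝ} (hs : 0 ≤ s)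
    (hL : 0 ≤ L) (hsL : s * L < 2) {θ : ℝ} (hθ : 0 < θ) (B : ℝ) :
    ∃ C T : ℝ, 0 ≤ C ∧ ∀ τ, T ≤ τ → ∀ n, |n| ≤ B → ∀ u,
      2 * f u * (u - (θ * τ + n)) + s * f u ^ 2 ≤ C * Real.exp (-(θ * τ)) := by
  have hη := hf.eta_pos
  have hub := hf.ubar_pos
  set A := (L * s / (2 - s * L) + 1) * s + s with hA
  have hA0 : 0 ≤ A := by
    have : 0 < 2 - s * L := by linarith
    positivity
  refine ⟨(4 * η + s * (4 * η ^ 2) + A * (4 * η ^ 2)) * Real.exp B, (ubar + 1 + B) / θ,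
    by positivity, ?_⟩
  intro τ hτ n hn u
  rw [div_le_iff₀ hθ] at hτ
  obtain ⟨hn1, hn2⟩ := abs_le.1 hn
  set g := θ * τ + n with hg
  have hgub : ubar < g := by linarith
  set x := Real.exp (-g) with hx
  have hxpos : 0 < x := Real.exp_pos _
  have hx1 : x ≤ 1 := Real.exp_le_one_iff.2 (by linarith)
  have hf2 : ∀ v, g ≤ v → f v ≤ 2 * η * x := fun v hv =>
    (hf.le_two_mul_exp (hgub.trans_le hv)).trans
      (mul_le_mul_of_nonneg_left (Real.exp_le_exp.2 (by linarith)) (by positivity))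
  have hfsq : ∀ v, g ≤ v → f v ^ 2 ≤ 4 * η ^ 2 * x := by
    intro v hv
    have h1 := pow_le_pow_left₀ (hf.pos v).le (hf2 v hv) 2
    have h2 : x * x ≤ x * 1 := mul_le_mul_of_nonneg_left hx1 hxpos.le
    have h3 := mul_le_mul_of_nonneg_left h2 (show 0 ≤ 4 * η ^ 2 by positivity)
    nlinarith
  have key := hf.drift_le hs hL hsL (q := 0) (g := g) (u := u)
    (E := 4 * η * x + s * (4 * η ^ 2 * x)) le_rfl (by positivity)
    (fun _ h => absurd (hf.pos u) (by linarith)) ?_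
  · simp only [sub_zero, add_zero] at key
    have h1 := mul_le_mul_of_nonneg_left (hfsq g le_rfl) hA0
    have h2 : x ≤ Real.exp B * Real.exp (-(θ * τ)) := by
      rw [← Real.exp_add]; exact Real.exp_le_exp.2 (by linarith)
    have h3 := mul_le_mul_of_nonneg_left h2
      (show 0 ≤ 4 * η + s * (4 * η ^ 2) + A * (4 * η ^ 2) by positivity)
    linarith
  · intro hug _
    have h1 : f u * (u - g) ≤ 2 * η * x := by
      have h2 := hf.le_two_mul_exp (hgub.trans_le hug)
      have h3 : Real.exp (-u) = x * Real.exp (-(u - g)) := by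
        rw [hx, ← Real.exp_add]; congr 1; ring
      have h4 : Real.exp (-(u - g)) * (u - g) ≤ 1 := by
        rw [Real.exp_neg, inv_mul_le_iff₀ (Real.exp_pos _)]
        linarith [Real.add_one_le_exp (u - g)]
      calc f u * (u - g) ≤ 2 * η * Real.exp (-u) * (u - g) :=
            mul_le_mul_of_nonneg_right h2 (by linarith)
        _ = 2 * η * x * (Real.exp (-(u - g)) * (u - g)) := by rw [h3]; ring
        _ ≤ 2 * η * x * 1 := mul_le_mul_of_nonneg_left h4 (by positivity)
        _ = 2 * η * x := mul_one _
    have h2 := mul_le_mul_of_nonneg_left (hfsq u hug) hs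
    linarith

/-- `f = -η ℓ'` is a tail map: the only point needing an argument is the lower bound on the left,
where `limsup ℓ' < 0` covers a neighbourhood of `-∞` and compactness the rest. -/
theorem exists_tailMap {ℓ : ℝ → ℝ} {β : ℝ} (hℓ : LossShape ℓ β) (htail : TightExpTail ℓ)
    {η : ℝ} (hη : 0 < η) :
    ∃ μ ubar δ, TailMap (fun u => -(η * deriv ℓ u)) η (η * β) μ ubar δ := by
  obtain ⟨μp, μm, ubar, hp, hm, hub, h⟩ := htail
  have hcont : Continuous (deriv ℓ) := by
    have : LipschitzWith (Real.toNNReal β) (deriv ℓ) := by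
      refine LipschitzWith.of_dist_le_mul fun u v => ?_
      rw [Real.dist_eq, Real.dist_eq]
      exact (hℓ.smooth u v).trans
        (mul_le_mul_of_nonneg_right (Real.le_coe_toNNReal β) (abs_nonneg _))
    exact this.continuous
  obtain ⟨b, hb1, hb2⟩ : ∃ b : ℝ, b < 0 ∧ ∀ᶠ u in atBot, deriv ℓ u < b := by
    obtain ⟨b, hb1, hb2⟩ := EReal.lt_iff_exists_real_btwn.1 hℓ.limsup_deriv_neg
    refine ⟨b, by exact_mod_cast hb2, ?_⟩
    filter_upwards [eventually_lt_of_limsup_lt hb1] with u hu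
    exact_mod_cast hu
  obtain ⟨A, hA⟩ := eventually_atBot.1 hb2
  obtain ⟨v, -, hv⟩ := (isCompact_Icc (a := min A ubar) (b := ubar)).exists_isMaxOn
    ⟨ubar, min_le_right _ _, le_rfl⟩ hcont.continuousOn
  refine ⟨min μp μm, ubar, η * min (-b) (-deriv ℓ v), hη, lt_min hp hm, hub,
    mul_pos hη (lt_min (by linarith) (by linarith [hℓ.deriv_neg v])), ?_, ?_, ?_, ?_, ?_⟩
  · intro u
    have := mul_pos hη (neg_pos.2 (hℓ.deriv_neg u))
    linarith
  · intro u v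
    have : -(η * deriv ℓ u) - -(η * deriv ℓ v) = -(η * (deriv ℓ u - deriv ℓ v)) := by ring
    rw [this, abs_neg, abs_mul, abs_of_pos hη, mul_assoc]
    exact mul_le_mul_of_nonneg_left (hℓ.smooth u v) hη.le
  · intro u hu
    have h1 := (h u hu).1
    have h2 : Real.exp (-μm * u) ≤ Real.exp (-min μp μm * u) :=
      Real.exp_le_exp.2 (by nlinarith [min_le_right μp μm])
    have h3 := mul_le_mul_of_nonneg_right h2 (Real.exp_pos (-u)).le
    have h4 := mul_le_mul_of_nonneg_left
      (show (1 - Real.exp (-min μp μm * u)) * Real.exp (-u) ≤ -deriv ℓ u by linarith) hη.le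
    linarith
  · intro u hu
    have h1 := (h u hu).2
    have h2 : Real.exp (-μp * u) ≤ Real.exp (-min μp μm * u) :=
      Real.exp_le_exp.2 (by nlinarith [min_le_left μp μm])
    have h3 := mul_le_mul_of_nonneg_right h2 (Real.exp_pos (-u)).le
    have h4 := mul_le_mul_of_nonneg_left
      (show -deriv ℓ u ≤ (1 + Real.exp (-min μp μm * u)) * Real.exp (-u) by linarith) hη.le
    linarith
  · intro u hu
    have h1 : min (-b) (-deriv ℓ v) ≤ -deriv ℓ u := by
      rcases le_or_gt u A with h | h
      · have := hA u h
        exact (min_le_left _ _).trans (by linarith)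
      · have : deriv ℓ u ≤ deriv ℓ v := hv ⟨(min_le_left _ _).trans h.le, hu⟩
        exact (min_le_right _ _).trans (by linarith)
    have := mul_le_mul_of_nonneg_left h1 hη.le
    linarith

end ContinualGD

namespace ContinualGD

/-! ### Fluctuations of the task order -/

/-- A centred random walk with independent bounded steps satisfies `∑ Rₛ² / s^{9/4} < ∞` almost
surely, since `E Rₛ²` grows at most linearly. -/
theorem ae_summable_sq_sum_div {Ω : Type*} [MeasurableSpace Ω] {P : Measure Ω}
    [IsProbabilityMeasure P] {Z : ℕ → Ω → ℝ} (hZ : ∀ s, Measurable (Z s))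
    (hindep : Pairwise fun s t => IndepFun (Z s) (Z t) P) {B : ℝ} (hB : ∀ s ω, |Z s ω| ≤ B)
    (hmean : ∀ s, ∫ ω, Z s ω ∂P = 0) :
    ∀ᵐ ω ∂P, Summable fun t : ℕ => (∑ s ∈ Finset.range t, Z s ω) ^ 2 / (t : ℝ) ^ (9 / 4 : ℝ) := by
  have hLp : ∀ s, MemLp (Z s) 2 P := fun s =>
    MemLp.of_bound (hZ s).aestronglyMeasurable B (ae_of_all _ fun ω => by
      rw [Real.norm_eq_abs]; exact hB s ω)
  have hvar : ∀ s, variance (Z s) P ≤ B ^ 2 := by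
    intro s
    rw [variance_eq_sub (hLp s), hmean s]
    have : ∫ ω, (Z s ^ 2) ω ∂P ≤ ∫ _, B ^ 2 ∂P := by
      refine integral_mono (hLp s).integrable_sq (integrable_const _) fun ω => ?_
      exact sq_le_sq' (abs_le.1 (hB s ω)).1 (abs_le.1 (hB s ω)).2
    simpa using this
  have hsumLp : ∀ t : ℕ, MemLp (∑ s ∈ Finset.range t, Z s) 2 P := fun t =>
    memLp_finsetSum' _ fun s _ => hLp s
  have hsq : ∀ t : ℕ, ∫ ω, (∑ s ∈ Finset.range t, Z s ω) ^ 2 ∂P ≤ t * B ^ 2 := by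
    intro t
    have h1 := IndepFun.variance_sum (μ := P) (X := Z) (s := Finset.range t) (fun s _ => hLp s)
      (fun i _ j _ hij => hindep hij)
    have h2 : ∫ ω, (∑ s ∈ Finset.range t, Z s) ω ∂P = 0 := by
      simp only [Finset.sum_apply]
      rw [integral_finsetSum _ fun s _ => (hLp s).integrable (by norm_num)]
      simp [hmean]
    rw [variance_eq_sub (hsumLp t), h2] at h1
    have h3 : ∑ s ∈ Finset.range t, variance (Z s) P ≤ ∑ s ∈ Finset.range t, B ^ 2 :=
      Finset.sum_le_sum fun s _ => hvar s
    simp only [Finset.sum_const, Finset.card_range, nsmul_eq_mul] at h3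
    simp only [Pi.pow_apply, Finset.sum_apply] at h1
    linarith
  have hint : ∀ t : ℕ, Integrable
      (fun ω => (∑ s ∈ Finset.range t, Z s ω) ^ 2 / (t : ℝ) ^ (9 / 4 : ℝ)) P := fun t => by
    have := (hsumLp t).integrable_sq
    simp only [Finset.sum_apply] at this
    exact this.div_const _
  have hnn : ∀ (t : ℕ) ω, 0 ≤ (∑ s ∈ Finset.range t, Z s ω) ^ 2 / (t : ℝ) ^ (9 / 4 : ℝ) :=
    fun t ω => by positivity
  have hsum : Summable fun t : ℕ => ∫ ω, ‖(∑ s ∈ Finset.range t, Z s ω) ^ 2 /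
      (t : ℝ) ^ (9 / 4 : ℝ)‖ ∂P := by
    have hS : Summable fun t : ℕ => B ^ 2 * (1 / (t : ℝ) ^ (5 / 4 : ℝ)) :=
      (Real.summable_one_div_nat_rpow.2 (by norm_num)).mul_left _
    refine Summable.of_nonneg_of_le (fun t => integral_nonneg fun ω => norm_nonneg _)
      (fun t => ?_) hS
    simp only [Real.norm_of_nonneg (hnn t _)]
    rw [integral_div]
    rcases Nat.eq_zero_or_pos t with rfl | ht
    · simp
    · have ht' : (0 : ℝ) < t := by exact_mod_cast ht
      have h1 : (t : ℝ) ^ (9 / 4 : ℝ) = t ^ (5 / 4 : ℝ) * t := by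
        rw [← Real.rpow_add_one ht'.ne']; norm_num
      have h2 : 0 < (t : ℝ) ^ (5 / 4 : ℝ) := Real.rpow_pos_of_pos ht' _
      rw [h1, div_le_iff₀ (by positivity)]
      calc _ ≤ t * B ^ 2 := hsq t
        _ = _ := by field_simp
  have hlint : ∫⁻ ω, ∑' t : ℕ, ‖(∑ s ∈ Finset.range t, Z s ω) ^ 2 /
      (t : ℝ) ^ (9 / 4 : ℝ)‖ₑ ∂P ≠ ⊤ := by
    rw [lintegral_tsum fun t => (hint t).aestronglyMeasurable.enorm]
    have : ∀ t : ℕ, ∫⁻ ω, ‖(∑ s ∈ Finset.range t, Z s ω) ^ 2 / (t : ℝ) ^ (9 / 4 : ℝ)‖ₑ ∂P =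
        ENNReal.ofReal (∫ ω, ‖(∑ s ∈ Finset.range t, Z s ω) ^ 2 / (t : ℝ) ^ (9 / 4 : ℝ)‖ ∂P) :=
      fun t => (ofReal_integral_norm_eq_lintegral_enorm (hint t)).symm
    simp only [this]
    exact hsum.tsum_ofReal_ne_top
  have hmeas : AEMeasurable (fun ω => ∑' t : ℕ, ‖(∑ s ∈ Finset.range t, Z s ω) ^ 2 /
      (t : ℝ) ^ (9 / 4 : ℝ)‖ₑ) P :=
    AEMeasurable.tsum fun t => (hint t).aestronglyMeasurable.enorm
  filter_upwards [ae_lt_top' hmeas hlint] with ω hω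
  have := ENNReal.summable_toReal hω.ne
  simpa [Real.norm_of_nonneg (hnn _ ω)] using this

/-- For independent uniform tasks, the number of visits to task `j` deviates from its mean by
little: the scaled deviations `R` satisfy `∑ Rₛ² / s^{9/4} < ∞` almost surely. -/
theorem IsUniformTaskOrder.ae_summable {Ω : Type*} [MeasurableSpace Ω] {P : Measure Ω}
    [IsProbabilityMeasure P] {M : ℕ} {m : ℕ → Ω → Fin M} (hm : IsUniformTaskOrder P m) :
    ∀ᵐ ω ∂P, ∀ j : Fin M, Summable fun t : ℕ =>
      (∑ s ∈ Finset.range t, ((if m s ω = j then (M : ℝ) else 0) - 1)) ^ 2 /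
        (t : ℝ) ^ (9 / 4 : ℝ) := by
  rw [ae_all_iff]
  intro j
  have hM : (0 : ℝ) < M := by exact_mod_cast j.pos
  have hg : Measurable fun i : Fin M => (if i = j then (M : ℝ) else 0) - 1 := measurable_of_finite _
  refine ae_summable_sq_sum_div (Z := fun s ω => (if m s ω = j then (M : ℝ) else 0) - 1) (B := M + 1)
    (fun s => hg.comp (hm.measurable s)) (fun s t hst => (hm.indep.indepFun hst).comp hg hg)
    (fun s ω => ?_) fun s => ?_
  · rw [abs_le]
    constructor <;> split_ifs <;> linarith
  · have hmeas : MeasurableSet {ω | m s ω = j} := hm.measurable s (measurableSet_singleton j)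
    have h1 : (fun ω => (if m s ω = j then (M : ℝ) else 0)) =
        Set.indicator {ω | m s ω = j} fun _ => (M : ℝ) := by
      ext ω; simp [Set.indicator_apply]
    have h2 : Integrable (fun ω => (if m s ω = j then (M : ℝ) else 0)) P := by
      rw [h1]; exact (integrable_const _).indicator hmeas
    rw [integral_sub h2 (integrable_const _), h1, integral_indicator_const _ hmeas, Measure.real,
      hm.uniform s j]
    simp [hM.ne']

/-- A walk `R` with `∑ Rₛ² / s^{9/4} < ∞` admits a *corrector*: a bounded sequence `n` with
increments `(R (t + 1) - R t) / t` and `∑ |nₜ| / t < ∞`. It is the tail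
`-∑_{s ≥ t} (R_{s+1} - R_s) / s`, which summation by parts turns into the absolutely convergent
`R_t / t - ∑_{s ≥ t} R_{s+1} / (s (s + 1))`. -/
theorem exists_corrector {R : ℕ → ℝ}
    (hsum : Summable fun t : ℕ => R t ^ 2 / (t : ℝ) ^ (9 / 4 : ℝ)) {B : ℝ}
    (hR : ∀ t : ℕ, |R t| ≤ B * t) :
    ∃ n : ℕ → ℝ, (∀ t, 1 ≤ t → n (t + 1) = n t + (R (t + 1) - R t) / t) ∧
      (∃ C, ∀ t, |n t| ≤ C) ∧ Summable fun t : ℕ => |n t| / t := by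
  have hrpow : ∀ p : ℝ, 1 < p → Summable fun t : ℕ => 1 / (t : ℝ) ^ p := fun p hp =>
    Real.summable_one_div_nat_rpow.2 hp
  -- the exponent `7/4` leaves room for the factor `t^{-1/4}` below
  have hb : Summable fun t : ℕ => |R t| / (t : ℝ) ^ (7 / 4 : ℝ) := by
    refine Summable.of_nonneg_of_le (fun t => by positivity) (fun t => ?_)
      (hsum.add (hrpow (5 / 4) (by norm_num)))
    rcases Nat.eq_zero_or_pos t with rfl | ht
    · have := hR 0
      simp only [Nat.cast_zero, mul_zero] at this
      have h0 : R 0 = 0 := abs_nonpos_iff.1 this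
      simp [h0]
    · have ht' : (0 : ℝ) < t := by exact_mod_cast ht
      set a := (t : ℝ) ^ (1 / 4 : ℝ) with ha
      have hapos : 0 < a := Real.rpow_pos_of_pos ht' _
      have h5 : (t : ℝ) ^ (5 / 4 : ℝ) = a ^ 5 := by
        rw [ha, ← Real.rpow_natCast, ← Real.rpow_mul ht'.le]; norm_num
      have h7 : (t : ℝ) ^ (7 / 4 : ℝ) = a ^ 7 := by
        rw [ha, ← Real.rpow_natCast, ← Real.rpow_mul ht'.le]; norm_num
      have h9 : (t : ℝ) ^ (9 / 4 : ℝ) = a ^ 9 := by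
        rw [ha, ← Real.rpow_natCast, ← Real.rpow_mul ht'.le]; norm_num
      rw [h5, h7, h9]
      have : R t ^ 2 / a ^ 9 + 1 / a ^ 5 = (R t ^ 2 + a ^ 4) / a ^ 9 := by field_simp
      rw [this, div_le_div_iff₀ (by positivity) (by positivity)]
      have h : |R t| * a ^ 2 ≤ R t ^ 2 + a ^ 4 := by
        rw [← sq_abs (R t)]
        nlinarith [sq_nonneg (|R t| - a ^ 2), sq_nonneg (|R t|), sq_nonneg (a ^ 2)]
      calc |R t| * a ^ 9 = |R t| * a ^ 2 * a ^ 7 := by ring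
        _ ≤ _ := by gcongr
  set b : ℕ → ℝ := fun t => |R (t + 1)| / ((t + 1 : ℕ) : ℝ) ^ (7 / 4 : ℝ) with hbdef
  have hbsum : Summable b := (summable_nat_add_iff 1).2 hb
  have hb0 : ∀ t, 0 ≤ b t := fun t => by positivity
  set a : ℕ → ℝ := fun s => R (s + 1) / (s * (s + 1)) with hadef
  have hab : ∀ t s : ℕ, 1 ≤ t → t ≤ s → |a s| ≤ 2 / (t : ℝ) ^ (1 / 4 : ℝ) * b s := by
    intro t s ht hts
    have ht' : (1 : ℝ) ≤ t := by exact_mod_cast ht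
    have hs' : (t : ℝ) ≤ s := by exact_mod_cast hts
    have hs1 : (0 : ℝ) < (s : ℝ) + 1 := by positivity
    have h1 : (t : ℝ) ^ (1 / 4 : ℝ) ≤ ((s : ℝ) + 1) ^ (1 / 4 : ℝ) :=
      Real.rpow_le_rpow (by positivity) (by linarith) (by norm_num)
    have h2 : 0 < (t : ℝ) ^ (1 / 4 : ℝ) := Real.rpow_pos_of_pos (by linarith) _
    have h3 : ((s : ℝ) + 1) ^ (7 / 4 : ℝ) * ((s : ℝ) + 1) ^ (1 / 4 : ℝ) = (s + 1) ^ 2 := by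
      rw [← Real.rpow_add hs1, ← Real.rpow_natCast]; norm_num
    have h4 : 0 < ((s : ℝ) + 1) ^ (7 / 4 : ℝ) := Real.rpow_pos_of_pos hs1 _
    simp only [hadef, hbdef]
    push_cast
    rw [abs_div, abs_of_pos (show (0 : ℝ) < s * (s + 1) by nlinarith), div_mul_div_comm,
      div_le_div_iff₀ (by nlinarith) (by positivity)]
    have h5 : (t : ℝ) ^ (1 / 4 : ℝ) * ((s : ℝ) + 1) ^ (7 / 4 : ℝ) ≤ 2 * (s * (s + 1)) := by
      have := mul_le_mul_of_nonneg_right h1 h4.le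
      nlinarith
    calc _ ≤ |R (s + 1)| * (2 * (s * (s + 1))) := by gcongr
      _ = _ := by ring
  have hasum : Summable a := by
    rw [← summable_nat_add_iff 1]
    refine Summable.of_norm_bounded (((summable_nat_add_iff 1).2 hbsum).mul_left 2) fun s => ?_
    have := hab 1 (s + 1) le_rfl (by omega)
    simpa using this
  set T : ℕ → ℝ := fun t => ∑' s, a (s + t) with hT
  have hTle : ∀ t : ℕ, 1 ≤ t → |T t| ≤ 2 * (∑' s, b s) * (1 / (t : ℝ) ^ (1 / 4 : ℝ)) := by
    intro t ht
    have h1 : Summable fun s => 2 / (t : ℝ) ^ (1 / 4 : ℝ) * b (s + t) :=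
      ((summable_nat_add_iff t).2 hbsum).mul_left _
    have h2 : |T t| ≤ ∑' s, 2 / (t : ℝ) ^ (1 / 4 : ℝ) * b (s + t) :=
      tsum_of_norm_bounded (f := fun s => a (s + t)) h1.hasSum fun s => hab t (s + t) ht (by omega)
    rw [tsum_mul_left] at h2
    have h3 : ∑' s, b (s + t) ≤ ∑' s, b s := by
      rw [← hbsum.sum_add_tsum_nat_add t]
      exact le_add_of_nonneg_left (Finset.sum_nonneg fun s _ => hb0 s)
    have h4 : 0 ≤ 2 / (t : ℝ) ^ (1 / 4 : ℝ) := by positivity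
    refine h2.trans ((mul_le_mul_of_nonneg_left h3 h4).trans (le_of_eq (by ring)))
  have hTsucc : ∀ t, T t = a t + T (t + 1) := by
    intro t
    have := ((summable_nat_add_iff t).2 hasum).tsum_eq_zero_add
    simp only [hT]
    rw [this, zero_add]
    congr 1
    refine tsum_congr fun s => ?_
    congr 1; ring
  refine ⟨fun t => R t / t - T t, ?_, ⟨max |T 0| (B + 2 * (∑' s, b s)), ?_⟩, ?_⟩
  · intro t ht
    have ht' : (0 : ℝ) < t := by exact_mod_cast ht
    have := hTsucc t
    simp only [this, hadef]
    push_cast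
    field_simp
    ring
  · intro t
    rcases Nat.eq_zero_or_pos t with rfl | ht
    · refine le_max_of_le_left ?_
      simp
    · refine le_max_of_le_right ?_
      have ht' : (0 : ℝ) < t := by exact_mod_cast ht
      have ht1 : (1 : ℝ) ≤ t := by exact_mod_cast ht
      have h1 : |R t / t| ≤ B := by
        rw [abs_div, abs_of_pos ht', div_le_iff₀ ht']; exact hR t
      have h2 : 1 / (t : ℝ) ^ (1 / 4 : ℝ) ≤ 1 := by
        rw [div_le_one (Real.rpow_pos_of_pos ht' _)]
        exact Real.one_le_rpow ht1 (by norm_num)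
      have h3 : 0 ≤ 2 * ∑' s, b s := mul_nonneg (by norm_num) (tsum_nonneg hb0)
      have h4 := mul_le_mul_of_nonneg_left h2 h3
      have := hTle t ht
      refine (abs_sub _ _).trans ?_
      linarith
  · refine Summable.of_nonneg_of_le (fun t => by positivity) (fun t => ?_)
      (hb.add ((hrpow (5 / 4) (by norm_num)).mul_left (2 * ∑' s, b s)))
    rcases Nat.eq_zero_or_pos t with rfl | ht
    · simp
    · have ht' : (0 : ℝ) < t := by exact_mod_cast ht
      have ht1 : (1 : ℝ) ≤ t := by exact_mod_cast ht
      have h1 : |R t / t| / t ≤ |R t| / (t : ℝ) ^ (7 / 4 : ℝ) := by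
        rw [abs_div, abs_of_pos ht', div_div]
        refine div_le_div_of_nonneg_left (abs_nonneg _) (Real.rpow_pos_of_pos ht' _) ?_
        rw [← sq, ← Real.rpow_natCast]
        exact Real.rpow_le_rpow_of_exponent_le ht1 (by norm_num)
      have h2 : |T t| / t ≤ 2 * (∑' s, b s) * (1 / (t : ℝ) ^ (5 / 4 : ℝ)) := by
        have h3 : (t : ℝ) ^ (5 / 4 : ℝ) = t ^ (1 / 4 : ℝ) * t := by
          rw [← Real.rpow_add_one ht'.ne']; norm_num
        rw [div_le_iff₀ ht', h3]
        refine (hTle t ht).trans (le_of_eq ?_)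
        have : 0 < (t : ℝ) ^ (1 / 4 : ℝ) := Real.rpow_pos_of_pos ht' _
        field_simp
      have h3 := div_le_div_of_nonneg_right (abs_sub (R t / t) (T t)) ht'.le
      rw [add_div] at h3
      linarith

/-- Replacing the increments `1 / t` by those of `log` costs a corrector as well: the centred
harmonic remainder `H_{t-1} - log t - γ` is at most `1 / t` in absolute value. -/
theorem exists_log_corrector :
    ∃ n : ℕ → ℝ, (∀ t : ℕ, 1 ≤ t →
        n (t + 1) = n t + (1 / t - (Real.log (t + 1) - Real.log t))) ∧
      (∃ C, ∀ t, |n t| ≤ C) ∧ Summable fun t : ℕ => |n t| / t := by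
  set n : ℕ → ℝ := fun t =>
    ((harmonic t : ℚ) : ℝ) - 1 / t - Real.log t - Real.eulerMascheroniConstant with hn
  have hle : ∀ t : ℕ, 1 ≤ t → |n t| ≤ 1 / t := by
    intro t ht
    obtain ⟨s, rfl⟩ : ∃ s, t = s + 1 := ⟨t - 1, by omega⟩
    have h1 := Real.eulerMascheroniSeq_lt_eulerMascheroniConstant s
    have h2 := Real.eulerMascheroniConstant_lt_eulerMascheroniSeq' (s + 1)
    simp only [Real.eulerMascheroniSeq, Real.eulerMascheroniSeq', Nat.succ_ne_zero, if_false] at h1 h2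
    simp only [hn]
    rw [abs_le]
    rw [harmonic_succ] at *
    push_cast at *
    simp only [one_div] at *
    constructor <;> linarith
  refine ⟨n, fun t ht => ?_, ⟨max |n 0| 1, fun t => ?_⟩, ?_⟩
  · simp only [hn, harmonic_succ]
    push_cast
    rw [one_div ((t : ℝ) + 1)]
    ring
  · rcases Nat.eq_zero_or_pos t with rfl | ht
    · exact le_max_left _ _
    · refine le_max_of_le_right ((hle t ht).trans ?_)
      have ht1 : (1 : ℝ) ≤ t := by exact_mod_cast ht
      rw [div_le_one (by linarith)]; exact ht1
  · refine Summable.of_nonneg_of_le (fun t => by positivity) (fun t => ?_)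
      (Real.summable_one_div_nat_pow.2 (le_refl 2))
    rcases Nat.eq_zero_or_pos t with rfl | ht
    · simp
    · have ht' : (0 : ℝ) < t := by exact_mod_cast ht
      rw [div_le_iff₀ ht']
      refine (hle t ht).trans (le_of_eq ?_)
      field_simp

end ContinualGD

namespace ContinualGD

/-! ### Geometry of the max-margin solution -/

variable {d N : ℕ} {x : Fin N → EuclideanSpace ℝ (Fin d)} {y : Fin N → ℝ}

theorem le_sSup_spectrum_mul_norm_sq (x : Fin N → EuclideanSpace ℝ (Fin d))
    (v : Fin d → ℝ) :
    (dataMatrix x).transpose.mulVec v ⬝ᵥ (dataMatrix x).transpose.mulVec v ≤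
      sSup (spectrum ℝ (dataMatrix x * (dataMatrix x).transpose)) * (v ⬝ᵥ v) := by
  set X := dataMatrix x
  set A := X * X.transpose with hA
  set lam := sSup (spectrum ℝ A) with hlam
  have hAH : A.IsHermitian := by
    rw [Matrix.IsHermitian, Matrix.conjTranspose_eq_transpose_of_trivial, hA,
      Matrix.transpose_mul, Matrix.transpose_transpose]
  have hpsd : (algebraMap ℝ (Matrix (Fin d) (Fin d) ℝ) lam - A).PosSemidef := by
    rw [Matrix.posSemidef_iff_isHermitian_and_spectrum_nonneg]
    constructor
    · refine Matrix.IsHermitian.sub ?_ hAH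
      rw [Matrix.IsHermitian, Matrix.conjTranspose_eq_transpose_of_trivial,
        Matrix.algebraMap_eq_diagonal, Matrix.diagonal_transpose]
    · rw [← spectrum.singleton_sub_eq]
      rintro _ ⟨_, rfl, b, hb, rfl⟩
      exact sub_nonneg.2 (le_csSup (Matrix.finite_real_spectrum (A := A)).bddAbove hb)
  have h := hpsd.dotProduct_mulVec_nonneg v
  rw [star_trivial, Matrix.sub_mulVec, dotProduct_sub, sub_nonneg,
    Algebra.algebraMap_eq_smul_one, Matrix.smul_mulVec, Matrix.one_mulVec, dotProduct_smul,
    smul_eq_mul, hA, ← Matrix.mulVec_mulVec, Matrix.dotProduct_mulVec, ← Matrix.mulVec_transpose] at h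
  exact h

/-- `σ_max` bounds the operator norm of the data matrix. -/
theorem norm_sum_smul_sq_le (x : Fin N → EuclideanSpace ℝ (Fin d)) (c : Fin N → ℝ) :
    ‖∑ i, c i • x i‖ ^ 2 ≤ sigmaMax x ^ 2 * ∑ i, c i ^ 2 := by
  set v := ∑ i, c i • x i with hv
  set lam := sSup (spectrum ℝ (dataMatrix x * (dataMatrix x).transpose)) with hlam
  have hvj : ∀ j, v j = ∑ i, c i * x i j := fun j => by simp [hv]
  have hvv : (v : Fin d → ℝ) ⬝ᵥ v = ‖v‖ ^ 2 := by
    rw [EuclideanSpace.real_norm_sq_eq, dotProduct]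
    exact Finset.sum_congr rfl fun j _ => (sq _).symm
  set u := (dataMatrix x).transpose.mulVec v with hu
  have hui : ∀ i, u i = ∑ j, x i j * v j := fun i => by
    simp [hu, Matrix.mulVec, dotProduct, dataMatrix]
  have hspec : ∑ i, u i ^ 2 ≤ lam * ‖v‖ ^ 2 := by
    have := le_sSup_spectrum_mul_norm_sq x v
    rw [hvv] at this
    refine le_trans (le_of_eq ?_) this
    rw [dotProduct]
    exact Finset.sum_congr rfl fun j _ => sq _
  have hcu : ‖v‖ ^ 2 = ∑ i, c i * u i := by
    rw [← hvv, dotProduct]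
    simp only [hui, Finset.mul_sum]
    rw [Finset.sum_comm]
    refine Finset.sum_congr rfl fun j _ => ?_
    nth_rewrite 1 [hvj j]
    rw [Finset.sum_mul]
    exact Finset.sum_congr rfl fun i _ => by ring
  have hcs : (‖v‖ ^ 2) ^ 2 ≤ (∑ i, c i ^ 2) * ∑ i, u i ^ 2 := by
    rw [hcu]; exact Finset.sum_mul_sq_le_sq_mul_sq _ _ _
  have hc0 : 0 ≤ ∑ i, c i ^ 2 := Finset.sum_nonneg fun i _ => sq_nonneg _
  rcases (sq_nonneg ‖v‖).eq_or_lt with h0 | hpos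
  · rw [← h0]; positivity
  · have hlam0 : 0 ≤ lam := by
      have : 0 ≤ lam * ‖v‖ ^ 2 := (Finset.sum_nonneg fun i _ => sq_nonneg (u i)).trans hspec
      exact nonneg_of_mul_nonneg_left this hpos
    have h1 : (‖v‖ ^ 2) * ‖v‖ ^ 2 ≤ (lam * ∑ i, c i ^ 2) * ‖v‖ ^ 2 := by
      have := mul_le_mul_of_nonneg_left hspec hc0
      nlinarith
    rw [sigmaMax, Real.sq_sqrt hlam0]
    exact le_of_mul_le_mul_right h1 hpos

theorem norm_le_sigmaMax (x : Fin N → EuclideanSpace ℝ (Fin d)) (i : Fin N) :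
    ‖x i‖ ≤ sigmaMax x := by
  have h := norm_sum_smul_sq_le x (Pi.single i 1)
  have h1 : ∑ j, (Pi.single i (1 : ℝ) : Fin N → ℝ) j • x j = x i := by
    simp [Pi.single_apply, Finset.sum_ite_eq']
  have h2 : ∑ j, (Pi.single i (1 : ℝ) : Fin N → ℝ) j ^ 2 = 1 := by
    simp [Pi.single_apply, ite_pow]
  rw [h1, h2, mul_one] at h
  exact le_of_sq_le_sq h (Real.sqrt_nonneg _)

variable (h : JointlySeparable x y)

theorem one_le_maxMarginSolution (i : Fin N) : 1 ≤ y i * inner ℝ (x i) (maxMarginSolution h) :=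
  (isMaxMarginSolution_maxMarginSolution h).1 i

theorem maxMarginSolution_ne_zero (hN : 0 < N) : maxMarginSolution h ≠ 0 := by
  intro h0
  have := one_le_maxMarginSolution h ⟨0, hN⟩
  rw [h0, inner_zero_right, mul_zero] at this
  linarith

/-- Some constraint is tight at the max-margin solution: otherwise it could be scaled down. -/
theorem exists_margin_eq_one (hN : 0 < N) :
    ∃ i, y i * inner ℝ (x i) (maxMarginSolution h) = 1 := by
  have : Nonempty (Fin N) := ⟨⟨0, hN⟩⟩
  set v := maxMarginSolution h with hv
  obtain ⟨i, hi⟩ := Finite.exists_min fun i => y i * inner ℝ (x i) v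
  refine ⟨i, le_antisymm ?_ (one_le_maxMarginSolution h i)⟩
  set a := y i * inner ℝ (x i) v with ha
  have ha1 : 1 ≤ a := one_le_maxMarginSolution h i
  have ha0 : 0 < a := by linarith
  have hmin := (isMaxMarginSolution_maxMarginSolution h).2 (a⁻¹ • v) fun j => by
    rw [inner_smul_right, mul_left_comm, ← div_eq_inv_mul, one_le_div ha0]
    exact hi j
  rw [← hv, norm_smul, mul_pow, Real.norm_of_nonneg (inv_nonneg.2 ha0.le)] at hmin
  have hvpos : 0 < ‖v‖ ^ 2 := by
    have := norm_pos_iff.2 (maxMarginSolution_ne_zero h hN)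
    positivity
  have h1 : 1 ≤ a⁻¹ ^ 2 := by
    by_contra hlt
    nlinarith
  rw [inv_pow, one_le_inv₀ (by positivity)] at h1
  nlinarith

theorem maxMargin_eq (hN : 0 < N) : maxMargin h = 1 / ‖maxMarginSolution h‖ := by
  have : Nonempty (Fin N) := ⟨⟨0, hN⟩⟩
  obtain ⟨i, hi⟩ := exists_margin_eq_one h hN
  refine le_antisymm ?_ (le_ciInf fun j => ?_)
  · rw [← hi]
    exact ciInf_le (Set.finite_range _).bddBelow i
  · exact div_le_div_of_nonneg_right (one_le_maxMarginSolution h j) (norm_nonneg _)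

theorem mem_supportVectors_iff (hN : 0 < N) {i : Fin N} :
    i ∈ supportVectors h ↔ y i * inner ℝ (x i) (maxMarginSolution h) = 1 := by
  have := norm_pos_iff.2 (maxMarginSolution_ne_zero h hN)
  rw [supportVectors, Finset.mem_filter, maxMargin_eq h hN, div_left_inj' this.ne']
  simp

theorem maxMargin_le_sigmaMax (hN : 0 < N) (hy : ∀ i, y i = 1 ∨ y i = -1) :
    maxMargin h ≤ sigmaMax x := by
  obtain ⟨i, hi⟩ := exists_margin_eq_one h hN
  have hv := norm_pos_iff.2 (maxMarginSolution_ne_zero h hN)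
  refine le_trans ?_ (norm_le_sigmaMax x i)
  rw [maxMargin_eq h hN, div_le_iff₀ hv, ← hi]
  have hyi : |y i| = 1 := by rcases hy i with h | h <;> simp [h]
  calc _ ≤ |y i * inner ℝ (x i) (maxMarginSolution h)| := le_abs_self _
    _ = |inner ℝ (x i) (maxMarginSolution h)| := by rw [abs_mul, hyi, one_mul]
    _ ≤ _ := abs_real_inner_le_norm _ _

/-- The learning rate condition implies the classical one, `η β σ_max² < 2`, as `φ ≤ σ_max`. -/
theorem sigmaMax_sq_mul_lt_two (hN : 0 < N) (hy : ∀ i, y i = 1 ∨ y i = -1) {η β : ℝ} (hη : 0 < η)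
    (hβ : 0 ≤ β) (hηlt : η < 2 * maxMargin h ^ 2 / (β * sigmaMax x ^ 4)) :
    sigmaMax x ^ 2 * (η * β) < 2 := by
  have hφ : 0 ≤ maxMargin h := by rw [maxMargin_eq h hN]; positivity
  have hφσ := pow_le_pow_left₀ hφ (maxMargin_le_sigmaMax h hN hy) 2
  -- a vanishing denominator would make the bound on `η` the junk value `0`
  have hden : 0 < β * sigmaMax x ^ 4 := by
    refine lt_of_le_of_ne (by positivity) fun h0 => ?_
    rw [← h0, div_zero] at hηlt
    linarith
  have hσ : 0 < sigmaMax x ^ 2 := by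
    refine lt_of_le_of_ne (by positivity) fun h0 => ?_
    have : sigmaMax x ^ 4 = (sigmaMax x ^ 2) ^ 2 := by ring
    rw [this, ← h0] at hden
    simp at hden
  rw [lt_div_iff₀ hden] at hηlt
  have : sigmaMax x ^ 2 * (η * β) * sigmaMax x ^ 2 < 2 * sigmaMax x ^ 2 := by nlinarith
  exact lt_of_mul_lt_mul_right this hσ.le

/-- Since positivity is an open condition, uniqueness of the positive coefficients makes the
support vectors linearly independent. -/
theorem NonDegenerate.linearIndependent (hnd : NonDegenerate h) :
    LinearIndependent ℝ fun i : supportVectors h => y i • x i := by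
  obtain ⟨α, ⟨hpos, hzero, hsum⟩, huniq⟩ := hnd
  rw [Fintype.linearIndependent_iff]
  intro g hg i
  set b : Fin N → ℝ := fun i => if hi : i ∈ supportVectors h then g ⟨i, hi⟩ else 0 with hb
  have hbS : ∀ i : supportVectors h, b i = g i := fun i => by simp [hb]
  have hbsum : ∑ i ∈ supportVectors h, (b i * y i) • x i = 0 := by
    rw [← Finset.sum_coe_sort, ← hg]
    exact Finset.sum_congr rfl fun i _ => by rw [hbS, mul_smul]
  have hsmall : ∀ᶠ ε : ℝ in 𝓝[>] 0, ∀ i ∈ supportVectors h, 0 < α i + ε * b i := by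
    rw [Finset.eventually_all]
    intro i hi
    have hc : ContinuousAt (fun ε : ℝ => α i + ε * b i) 0 := by fun_prop
    refine (hc.eventually (lt_mem_nhds ?_)).filter_mono nhdsWithin_le_nhds
    simpa using hpos i hi
  obtain ⟨ε, hε, hεpos⟩ := (hsmall.and self_mem_nhdsWithin).exists
  have heq : (fun i => α i + ε * b i) = α := by
    refine huniq _ ⟨hε, fun i hi => by simp [hzero i hi, hb, hi], ?_⟩
    simp only [add_mul, add_smul, Finset.sum_add_distrib, ← hsum, mul_assoc, mul_smul ε]
    rw [← Finset.smul_sum, hbsum, smul_zero, add_zero]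
  have := congrFun heq i
  simp only [add_eq_left, mul_eq_zero, hbS] at this
  exact this.resolve_left (ne_of_gt hεpos)

theorem _root_.LinearIndependent.exists_inner_eq {ι E : Type*} [NormedAddCommGroup E]
    [InnerProductSpace ℝ E] [FiniteDimensional ℝ E] {v : ι → E} (hv : LinearIndependent ℝ v)
    (c : ι → ℝ) : ∃ w : E, ∀ i, inner ℝ (v i) w = c i := by
  have : CompleteSpace E := FiniteDimensional.complete ℝ E
  obtain ⟨g, hg⟩ := LinearMap.exists_extend ((Module.Basis.span hv).constr ℝ c)
  refine ⟨(InnerProductSpace.toDual ℝ E).symm (LinearMap.toContinuousLinearMap g), fun i => ?_⟩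
  rw [real_inner_comm, InnerProductSpace.toDual_symm_apply]
  have h1 := LinearMap.congr_fun hg (Module.Basis.span hv i)
  rw [Module.Basis.constr_basis] at h1
  rw [← h1]
  simp [Module.Basis.span_apply]

/-- There is an offset `w̃` prescribing the margins of the support vectors. -/
theorem NonDegenerate.exists_inner_eq (hnd : NonDegenerate h) (c : Fin N → ℝ) :
    ∃ w : EuclideanSpace ℝ (Fin d), ∀ i ∈ supportVectors h, inner ℝ (y i • x i) w = c i := by
  obtain ⟨w, hw⟩ := (hnd.linearIndependent h).exists_inner_eq fun i => c i
  exact ⟨w, fun i hi => hw ⟨i, hi⟩⟩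

end ContinualGD

namespace ContinualGD

/-! ### The residual of the dynamics stays bounded -/

/-- With `τ = log t`, the drift bounds for a single data point are summable in `t`. The point is
either a support vector (margin `b = 1`) or has margin `b > 1` and target step `0`. -/
theorem TailMap.exists_summable_drift {f : ℝ → ℝ} {η L μ ubar δ : ℝ}
    (hf : TailMap f η L μ ubar δ) {s : ℝ} (hs : 0 ≤ s) (hL : 0 ≤ L) (hsL : s * L < 2)
    {a b c : ℝ} (hcase : (b = 1 ∧ a = η * Real.exp (-c)) ∨ (1 < b ∧ a = 0))
    {ν : ℕ → ℝ} {B : ℝ} (hν0 : ∀ t, 0 ≤ ν t) (hνB : ∀ t, ν t ≤ B)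
    (hν : Summable fun t : ℕ => ν t / t) :
    ∃ e : ℕ → ℝ, Summable e ∧ (∀ t, 0 ≤ e t) ∧ ∀ᶠ t : ℕ in atTop, ∀ n, |n| ≤ ν t → ∀ u,
      2 * (f u - a / t) * (u - (b * Real.log t + c + n)) + s * (f u - a / t) ^ 2 ≤ e t := by
  have hlog : Tendsto (fun t : ℕ => Real.log t) atTop atTop :=
    Real.tendsto_log_atTop.comp tendsto_natCast_atTop_atTop
  have hexp : ∀ (p : ℝ) (t : ℕ), 1 ≤ t → Real.exp (-(p * Real.log t)) = 1 / (t : ℝ) ^ p := by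
    intro p t ht
    rw [Real.rpow_def_of_pos (by exact_mod_cast ht), Real.exp_neg, one_div, mul_comm]
  rcases hcase with ⟨rfl, rfl⟩ | ⟨hb, rfl⟩
  · obtain ⟨C, T, hC, H⟩ := hf.exists_drift_le_support hs hL hsL c B
    have hμ := hf.mu_pos
    refine ⟨fun t => C * (ν t / t + 1 / (t : ℝ) ^ (1 + μ) + 1 / (t : ℝ) ^ (1 + 1 : ℝ)),
      ((hν.add (Real.summable_one_div_nat_rpow.2 (by linarith))).add
        (Real.summable_one_div_nat_rpow.2 (by norm_num))).mul_left C,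
      fun t => by have := hν0 t; positivity, ?_⟩
    filter_upwards [hlog.eventually_ge_atTop T, eventually_ge_atTop 1] with t ht ht1 n hn u
    have ht' : (0 : ℝ) < t := by exact_mod_cast ht1
    have h1 : Real.exp (-Real.log t) = 1 / t := by
      rw [Real.exp_neg, Real.exp_log ht', one_div]
    have h2 := hexp μ t ht1
    rw [← neg_mul] at h2
    have key := H (Real.log t) ht n (hn.trans (hνB t)) u
    rw [h1, h2, mul_one_div] at key
    rw [one_mul]
    refine key.trans ?_
    rw [Real.rpow_add ht', Real.rpow_add ht', Real.rpow_one, mul_assoc]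
    refine mul_le_mul_of_nonneg_left ?_ hC
    have h3 : |n| / t ≤ ν t / t := div_le_div_of_nonneg_right hn ht'.le
    have h4 : 1 / (t : ℝ) * (|n| + 1 / (t : ℝ) ^ μ + 1 / t) =
        |n| / t + 1 / (t * (t : ℝ) ^ μ) + 1 / (t * t) := by
      have : 0 < (t : ℝ) ^ μ := Real.rpow_pos_of_pos ht' _
      field_simp
    rw [h4]
    gcongr
  · obtain ⟨C, T, hC, H⟩ := hf.exists_drift_le_nonsupport hs hL hsL (by linarith : 0 < b) (|c| + B)
    refine ⟨fun t => C * (1 / (t : ℝ) ^ b), (Real.summable_one_div_nat_rpow.2 hb).mul_left C,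
      fun t => by positivity, ?_⟩
    filter_upwards [hlog.eventually_ge_atTop T, eventually_ge_atTop 1] with t ht ht1 n hn u
    have key := H (Real.log t) ht (c + n)
      ((abs_add_le c n).trans (add_le_add_right (hn.trans (hνB t)) _)) u
    rw [hexp b t ht1, ← add_assoc] at key
    simpa using key

variable {ι E : Type*} [NormedAddCommGroup E] [InnerProductSpace ℝ E]

theorem norm_add_sum_smul_sq_le {v : ι → E} {s : ℝ} {J : Finset ι} {D : ι → ℝ}
    (hv : ‖∑ i ∈ J, D i • v i‖ ^ 2 ≤ s * ∑ i ∈ J, D i ^ 2) (r : E) :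
    ‖r + ∑ i ∈ J, D i • v i‖ ^ 2 ≤
      ‖r‖ ^ 2 + ∑ i ∈ J, (2 * D i * inner ℝ (v i) r + s * D i ^ 2) := by
  rw [norm_add_sq_real, real_inner_comm, sum_inner, Finset.sum_add_distrib, ← Finset.mul_sum]
  have : 2 * ∑ i ∈ J, inner ℝ (D i • v i) r = ∑ i ∈ J, 2 * D i * inner ℝ (v i) r := by
    rw [Finset.mul_sum]
    exact Finset.sum_congr rfl fun i _ => by rw [real_inner_smul_left, mul_assoc]
  linarith

/-- Boundedness of `w - log t • ŵ` for stagewise dynamics with steps `∑ i ∈ J t, f ⟪vᵢ, w⟫ • vᵢ`.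
The comparison path moves by `(aᵢ / t) • vᵢ` per step instead; since the corrector `n` is bounded and
`∑ ‖nₜ‖ / t < ∞`, it stays within bounded distance of `log t • ŵ`, and the squared distance of the
iterates to the comparison path has summable increments. -/
theorem TailMap.exists_norm_sub_log_smul_le [Fintype ι] {f : ℝ → ℝ} {η L μ ubar δ : ℝ}
    (hf : TailMap f η L μ ubar δ) {s : ℝ} (hs : 0 ≤ s) (hL : 0 ≤ L) (hsL : s * L < 2)
    {v : ι → E} (hv : ∀ (J : Finset ι) (D : ι → ℝ),
      ‖∑ i ∈ J, D i • v i‖ ^ 2 ≤ s * ∑ i ∈ J, D i ^ 2)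
    {what wtilde : E} {a : ι → ℝ} (ha : ∀ i, 0 ≤ a i)
    (hcase : ∀ i, (inner ℝ (v i) what = 1 ∧ a i = η * Real.exp (-inner ℝ (v i) wtilde)) ∨
      (1 < inner ℝ (v i) what ∧ a i = 0))
    {K : ℕ} {J : ℕ → Finset ι} {w : ℕ → ℕ → E}
    (hstep : ∀ t k, w t (k + 1) = w t k + ∑ i ∈ J t, f (inner ℝ (v i) (w t k)) • v i)
    (hstage : ∀ t, w (t + 1) 0 = w t K)
    {n : ℕ → E} {B : ℝ} (hnB : ∀ t, ‖n t‖ ≤ B) (hnsum : Summable fun t : ℕ => ‖n t‖ / t)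
    (hn : ∀ t : ℕ, 1 ≤ t → n (t + 1) = n t + (K / t : ℝ) • ∑ i ∈ J t, a i • v i -
      (Real.log (t + 1) - Real.log t) • what) :
    ∃ C, ∀ t : ℕ, 1 ≤ t → ∀ k < K, ‖w t k - Real.log t • what‖ ≤ C := by
  set p : ℕ → E := fun t => ∑ i ∈ J t, a i • v i with hp
  set Q := ∑ i, a i * ‖v i‖ with hQ
  set V := ∑ i, ‖v i‖ with hV
  have hV0 : 0 ≤ V := Finset.sum_nonneg fun i _ => norm_nonneg _
  have hQ0 : 0 ≤ Q := Finset.sum_nonneg fun i _ => mul_nonneg (ha i) (norm_nonneg _)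
  have hpQ : ∀ t, ‖p t‖ ≤ Q := by
    intro t
    refine (norm_sum_le _ _).trans ?_
    refine (Finset.sum_le_sum_of_subset_of_nonneg (Finset.subset_univ _)
      fun i _ _ => norm_nonneg _).trans (le_of_eq (Finset.sum_congr rfl fun i _ => ?_))
    rw [norm_smul, Real.norm_of_nonneg (ha i)]
  set ν : ℕ → ℝ := fun t => V * (‖n t‖ + K * Q / t) with hν
  have hkp : ∀ t k : ℕ, k ≤ K → ‖n t + (k / t : ℝ) • p t‖ ≤ ‖n t‖ + K * Q / t := by
    intro t k hk
    have hk' : (k : ℝ) ≤ K := by exact_mod_cast hk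
    refine (norm_add_le _ _).trans (add_le_add_right ?_ _)
    rw [norm_smul, Real.norm_of_nonneg (by positivity), div_mul_eq_mul_div]
    exact div_le_div_of_nonneg_right
      (mul_le_mul hk' (hpQ t) (norm_nonneg _) (by positivity)) (by positivity)
  have hKQ : ∀ t : ℕ, K * Q / t ≤ K * Q := by
    intro t
    rcases Nat.eq_zero_or_pos t with rfl | ht
    · simp only [Nat.cast_zero, div_zero]; positivity
    · exact div_le_self (by positivity) (by exact_mod_cast ht)
  have hν0 : ∀ t, 0 ≤ ν t := fun t => by positivity
  have hνB : ∀ t, ν t ≤ V * (B + K * Q) := fun t =>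
    mul_le_mul_of_nonneg_left (add_le_add (hnB t) (hKQ t)) hV0
  have hνsum : Summable fun t : ℕ => ν t / t := by
    refine ((hnsum.add ((Real.summable_one_div_nat_pow.2 (le_refl 2)).mul_left (K * Q))).mul_left
      V).congr fun t => ?_
    simp only [hν]
    ring
  choose e hesum he0 hele using fun i => hf.exists_summable_drift hs hL hsL (hcase i) hν0 hνB hνsum
  set ε : ℕ → ℝ := fun t => ∑ i, e i t with hε
  have hεsum : Summable ε := summable_sum fun i _ => hesum i
  have hε0 : ∀ t, 0 ≤ ε t := fun t => Finset.sum_nonneg fun i _ => he0 i t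
  set g : ℕ → ℕ → E := fun t k =>
    Real.log t • what + wtilde + (n t + (k / t : ℝ) • p t) with hg
  set r : ℕ → ℕ → E := fun t k => w t k - g t k with hr
  have hrstep : ∀ t k, r t (k + 1) =
      r t k + ∑ i ∈ J t, (f (inner ℝ (v i) (w t k)) - a i / t) • v i := by
    intro t k
    have h1 : ∑ i ∈ J t, (f (inner ℝ (v i) (w t k)) - a i / t) • v i =
        ∑ i ∈ J t, f (inner ℝ (v i) (w t k)) • v i - (1 / t : ℝ) • p t := by
      rw [hp, Finset.smul_sum, ← Finset.sum_sub_distrib]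
      refine Finset.sum_congr rfl fun i _ => ?_
      rw [sub_smul, smul_smul]; congr 2; ring
    simp only [hr, hg]
    rw [h1, hstep]
    push_cast
    rw [add_div, add_smul]
    abel
  have hrstage : ∀ t, 1 ≤ t → r (t + 1) 0 = r t K := by
    intro t ht
    simp only [hr, hg, hstage, hn t ht]
    push_cast
    rw [sub_smul]
    simp only [zero_div, zero_smul, hp]
    abel
  have hdesc : ∀ᶠ t : ℕ in atTop, ∀ k < K, ‖r t (k + 1)‖ ^ 2 ≤ ‖r t k‖ ^ 2 + ε t := by
    filter_upwards [eventually_all.2 hele] with t ht k hk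
    rw [hrstep]
    refine (norm_add_sum_smul_sq_le (hv _ _) _).trans (add_le_add_right ?_ _)
    refine (Finset.sum_le_sum fun i _ => ?_).trans (Finset.sum_le_sum_of_subset_of_nonneg
      (Finset.subset_univ _) fun i _ _ => he0 i t)
    have h1 : |inner ℝ (v i) (n t + (k / t : ℝ) • p t)| ≤ ν t := by
      refine (abs_real_inner_le_norm _ _).trans (mul_le_mul ?_ (hkp t k hk.le) (norm_nonneg _) hV0)
      exact Finset.single_le_sum (f := fun i => ‖v i‖) (fun i _ => norm_nonneg _)
        (Finset.mem_univ i)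
    have h2 := ht i _ h1 (inner ℝ (v i) (w t k))
    have h3 : inner ℝ (v i) (r t k) = inner ℝ (v i) (w t k) -
        (inner ℝ (v i) what * Real.log t + inner ℝ (v i) wtilde +
          inner ℝ (v i) (n t + (k / t : ℝ) • p t)) := by
      simp only [hr, hg]
      rw [inner_sub_right, inner_add_right, inner_add_right, inner_smul_right, mul_comm]
    rw [h3]
    exact h2
  obtain ⟨T, hT⟩ := eventually_atTop.1 (hdesc.and (eventually_ge_atTop 1))
  have hstages : ∀ t, T ≤ t → ∀ k ≤ K, ‖r t k‖ ^ 2 ≤ ‖r t 0‖ ^ 2 + k * ε t := by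
    intro t ht k
    induction k with
    | zero => intro _; simp
    | succ k ih =>
      intro hk
      have h1 := ih (by omega)
      have h2 := (hT t ht).1 k (by omega)
      push_cast
      linarith
  have hzero : ∀ l, ‖r (T + l) 0‖ ^ 2 ≤ ‖r T 0‖ ^ 2 + K * ∑ i ∈ Finset.range l, ε (T + i) := by
    intro l
    induction l with
    | zero => simp
    | succ l ih =>
      have h1 := hstages (T + l) (by omega) K le_rfl
      rw [← hrstage (T + l) (hT (T + l) (by omega)).2] at h1
      rw [Finset.sum_range_succ, ← add_assoc T l 1]
      linarith
  set W := ‖r T 0‖ ^ 2 + K * (∑' t, ε t) + K * (∑' t, ε t) with hW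
  have hrW : ∀ t, T ≤ t → ∀ k < K, ‖r t k‖ ^ 2 ≤ W := by
    intro t ht k hk
    obtain ⟨l, rfl⟩ := Nat.exists_eq_add_of_le ht
    have h1 := hstages (T + l) ht k hk.le
    have h2 : ∑ i ∈ Finset.range l, ε (T + i) ≤ ∑' t, ε t := by
      rw [Finset.range_eq_Ico, Finset.sum_Ico_add ε 0 l T]
      exact hεsum.sum_le_tsum _ fun i _ => hε0 i
    have h3 : ε (T + l) ≤ ∑' t, ε t := hεsum.le_tsum _ fun i _ => hε0 i
    have hk' : (k : ℝ) ≤ K := by exact_mod_cast hk.le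
    have h4 : (k : ℝ) * ε (T + l) ≤ K * ∑' t, ε t :=
      mul_le_mul hk' h3 (hε0 _) (by positivity)
    have h5 := mul_le_mul_of_nonneg_left h2 (show (0 : ℝ) ≤ K by positivity)
    linarith [hzero l]
  refine ⟨√W + (‖wtilde‖ + (B + K * Q)) +
    ∑ t ∈ Finset.range T, ∑ k ∈ Finset.range K, ‖w t k - Real.log t • what‖, fun t _ k hk => ?_⟩
  have hB0 : 0 ≤ B := (norm_nonneg _).trans (hnB 0)
  have hsum0 : 0 ≤ ∑ t ∈ Finset.range T, ∑ k ∈ Finset.range K, ‖w t k - Real.log t • what‖ :=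
    Finset.sum_nonneg fun _ _ => Finset.sum_nonneg fun _ _ => norm_nonneg _
  rcases lt_or_ge t T with htT | htT
  · have h1 : ‖w t k - Real.log t • what‖ ≤
        ∑ k ∈ Finset.range K, ‖w t k - Real.log t • what‖ :=
      Finset.single_le_sum (f := fun k => ‖w t k - Real.log t • what‖)
        (fun _ _ => norm_nonneg _) (Finset.mem_range.2 hk)
    have h2 := Finset.single_le_sum
      (f := fun t : ℕ => ∑ k ∈ Finset.range K, ‖w t k - Real.log t • what‖)
      (fun _ _ => Finset.sum_nonneg fun _ _ => norm_nonneg _) (Finset.mem_range.2 htT)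
    have h3 : 0 ≤ √W + (‖wtilde‖ + (B + K * Q)) := by positivity
    linarith
  · have h1 : ‖r t k‖ ≤ √W := Real.le_sqrt_of_sq_le (hrW t htT k hk)
    have h2 : w t k - Real.log t • what = r t k + (wtilde + (n t + (k / t : ℝ) • p t)) := by
      simp only [hr, hg]; abel
    have h3 := hkp t k hk.le
    have h4 := norm_add_le (r t k) (wtilde + (n t + (k / t : ℝ) • p t))
    have h5 := norm_add_le wtilde (n t + (k / t : ℝ) • p t)
    rw [h2]
    linarith [hnB t, hKQ t]

end ContinualGD

namespace ContinualGD

/-! ### Sequential gradient descent -/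

theorem gradient_taskLoss {d N : ℕ} (x : Fin N → EuclideanSpace ℝ (Fin d)) (y : Fin N → ℝ)
    {ℓ : ℝ → ℝ} (hℓ : Differentiable ℝ ℓ) (I : Finset (Fin N)) (w : EuclideanSpace ℝ (Fin d)) :
    gradient (taskLoss x y ℓ I) w =
      ∑ i ∈ I, deriv ℓ (inner ℝ (y i • x i) w) • (y i • x i) := by
  refine HasGradientAt.gradient ?_
  rw [hasGradientAt_iff_hasFDerivAt, map_sum]
  have heq : taskLoss x y ℓ I = fun w => ∑ i ∈ I, ℓ (inner ℝ (y i • x i) w) := by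
    ext w
    simp only [taskLoss, real_inner_smul_left]
  rw [heq]
  refine HasFDerivAt.fun_sum fun i _ => ?_
  have h1 : HasFDerivAt (fun w : EuclideanSpace ℝ (Fin d) => inner ℝ (y i • x i) w)
      (InnerProductSpace.toDual ℝ _ (y i • x i)) w :=
    (InnerProductSpace.toDual ℝ (EuclideanSpace ℝ (Fin d)) (y i • x i)).hasFDerivAt
  rw [map_smul]
  exact (hℓ _).hasDerivAt.comp_hasFDerivAt w h1

/-- The direction of `log t • v + O(1)` converges to that of `v`. -/
theorem tendsto_normalize_of_norm_sub_log_smul_le {E : Type*} [NormedAddCommGroup E]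
    [NormedSpace ℝ E] {v : E} (hv : v ≠ 0) {w : ℕ → E} {C : ℝ}
    (h : ∀ t : ℕ, 1 ≤ t → ‖w t - Real.log t • v‖ ≤ C) :
    Tendsto (fun t => ‖w t‖⁻¹ • w t) atTop (𝓝 (‖v‖⁻¹ • v)) := by
  have hlog : Tendsto (fun t : ℕ => Real.log t) atTop atTop :=
    Real.tendsto_log_atTop.comp tendsto_natCast_atTop_atTop
  have h1 : Tendsto (fun t : ℕ => (Real.log t)⁻¹ • w t) atTop (𝓝 v) := by
    rw [tendsto_iff_norm_sub_tendsto_zero]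
    have h2 : Tendsto (fun t : ℕ => (Real.log t)⁻¹ * C) atTop (𝓝 0) := by
      simpa using hlog.inv_tendsto_atTop.mul_const C
    refine squeeze_zero' (Eventually.of_forall fun t => norm_nonneg _) ?_ h2
    filter_upwards [hlog.eventually_gt_atTop 0, eventually_ge_atTop 1] with t ht ht1
    have : (Real.log t)⁻¹ • w t - v = (Real.log t)⁻¹ • (w t - Real.log t • v) := by
      rw [smul_sub, smul_smul, inv_mul_cancel₀ ht.ne', one_smul]
    rw [this, norm_smul, Real.norm_of_nonneg (inv_nonneg.2 ht.le)]
    exact mul_le_mul_of_nonneg_left (h t ht1) (inv_nonneg.2 ht.le)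
  refine ((h1.norm.inv₀ (norm_ne_zero_iff.2 hv)).smul h1).congr' ?_
  filter_upwards [hlog.eventually_gt_atTop 0] with t ht
  rw [norm_smul, Real.norm_of_nonneg (inv_nonneg.2 ht.le), mul_inv, inv_inv, smul_smul]
  congr 1
  field_simp

/-- Corrector for the random task order: if `∑ⱼ Aⱼ = ŵ`, the walk with steps `(M / t) • A_{jₜ}`
follows `log t • ŵ` up to a bounded sequence `n` with `∑ ‖nₜ‖ / t < ∞`. -/
theorem exists_taskOrder_corrector {E : Type*} [NormedAddCommGroup E] [NormedSpace ℝ E] {M : ℕ}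
    {A : Fin M → E} {j : ℕ → Fin M}
    (hj : ∀ i : Fin M, Summable fun t : ℕ =>
      (∑ s ∈ Finset.range t, ((if j s = i then (M : ℝ) else 0) - 1)) ^ 2 /
        (t : ℝ) ^ (9 / 4 : ℝ)) :
    ∃ n : ℕ → E, (∀ t : ℕ, 1 ≤ t → n (t + 1) =
        n t + (M / t : ℝ) • A (j t) - (Real.log (t + 1) - Real.log t) • ∑ i, A i) ∧
      (∃ B, ∀ t, ‖n t‖ ≤ B) ∧ Summable fun t : ℕ => ‖n t‖ / t := by
  have hR : ∀ (i : Fin M) (t : ℕ),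
      |∑ s ∈ Finset.range t, ((if j s = i then (M : ℝ) else 0) - 1)| ≤ ((M : ℝ) + 1) * t := by
    intro i t
    have hM : (0 : ℝ) ≤ M := by positivity
    refine (Finset.abs_sum_le_sum_abs _ _).trans
      ((Finset.sum_le_card_nsmul _ _ ((M : ℝ) + 1) fun s _ => ?_).trans (le_of_eq ?_))
    · rw [abs_le]
      constructor <;> split_ifs <;> linarith
    · rw [Finset.card_range, nsmul_eq_mul, mul_comm]
  choose n hn hnB hnsum using fun i => exists_corrector (hj i) (hR i)
  choose B hB using hnB
  obtain ⟨n', hn', ⟨B', hB'⟩, hnsum'⟩ := exists_log_corrector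
  have hnorm : ∀ t, ‖n' t • ∑ i, A i + ∑ i, n i t • A i‖ ≤
      |n' t| * ‖∑ i, A i‖ + ∑ i, |n i t| * ‖A i‖ := by
    intro t
    refine (norm_add_le _ _).trans (add_le_add ?_ ((norm_sum_le _ _).trans ?_))
    · rw [norm_smul, Real.norm_eq_abs]
    · exact Finset.sum_le_sum fun i _ => by rw [norm_smul, Real.norm_eq_abs]
  refine ⟨fun t => n' t • ∑ i, A i + ∑ i, n i t • A i, fun t ht => ?_,
    ⟨B' * ‖∑ i, A i‖ + ∑ i, B i * ‖A i‖, fun t => (hnorm t).trans ?_⟩, ?_⟩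
  · have ht' : (t : ℝ) ≠ 0 := by positivity
    have h1 : ∑ i, n i (t + 1) • A i =
        ∑ i, n i t • A i + ((M / t : ℝ) • A (j t) - (1 / t : ℝ) • ∑ i, A i) := by
      have h2 : ∀ i, n i (t + 1) • A i = n i t • A i +
          ((if j t = i then (M / t : ℝ) • A i else 0) - (1 / t : ℝ) • A i) := by
        intro i
        rw [hn i t ht, Finset.sum_range_succ, add_sub_cancel_left, add_smul, sub_div, sub_smul]
        split_ifs <;> simp
      simp only [h2, Finset.sum_add_distrib, Finset.sum_sub_distrib, Finset.smul_sum,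
        Finset.sum_ite_eq, Finset.mem_univ, if_true]
    beta_reduce
    rw [h1, hn' t ht, add_smul, sub_smul]
    abel
  · exact add_le_add (mul_le_mul_of_nonneg_right (hB' t) (norm_nonneg _))
      (Finset.sum_le_sum fun i _ => mul_le_mul_of_nonneg_right (hB i t) (norm_nonneg _))
  · refine Summable.of_nonneg_of_le (fun t => by positivity)
      (fun t => div_le_div_of_nonneg_right (hnorm t) (by positivity))
      (((hnsum'.mul_right ‖∑ i, A i‖).add
        (summable_sum (s := Finset.univ) fun i _ => (hnsum i).mul_right ‖A i‖)).congr fun t => ?_)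
    rw [add_div, Finset.sum_div]
    congr 1
    · ring
    · exact Finset.sum_congr rfl fun i _ => by ring

/-- The pathwise statement: boundedness of `w - log t • ŵ` for every task order whose visit counts
deviate little from their means. -/
theorem exists_norm_seqGD_sub_log_smul_le {d N M K : ℕ} (hN : 0 < N) (hK : 1 ≤ K)
    {x : Fin N → EuclideanSpace ℝ (Fin d)} {y : Fin N → ℝ} (hy : ∀ i, y i = 1 ∨ y i = -1)
    {I : Fin M → Finset (Fin N)} (hI : ∀ i, ∃! j, i ∈ I j)
    (hsep : JointlySeparable x y) (hnd : NonDegenerate hsep)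
    {ℓ : ℝ → ℝ} {β : ℝ} (hℓ : LossShape ℓ β) (htail : TightExpTail ℓ) {η : ℝ} (hη : 0 < η)
    (hηlt : η < 2 * maxMargin hsep ^ 2 / (β * sigmaMax x ^ 4))
    (w₀ : EuclideanSpace ℝ (Fin d)) {j : ℕ → Fin M}
    (hj : ∀ i : Fin M, Summable fun t : ℕ =>
      (∑ s ∈ Finset.range t, ((if j s = i then (M : ℝ) else 0) - 1)) ^ 2 /
        (t : ℝ) ^ (9 / 4 : ℝ)) :
    ∃ C, ∀ t : ℕ, 1 ≤ t → ∀ k < K,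
      ‖seqGD η K (fun s => taskLoss x y ℓ (I (j s))) w₀ t k -
        Real.log t • maxMarginSolution hsep‖ ≤ C := by
  have hβ : 0 ≤ β := by
    have := (abs_nonneg _).trans (hℓ.smooth 1 0)
    simpa using this
  obtain ⟨μ, ubar, δ, hf⟩ := exists_tailMap hℓ htail hη
  obtain ⟨α, ⟨hαpos, hαzero, hαsum⟩, -⟩ := id hnd
  have hM : (0 : ℝ) < M := by exact_mod_cast (j 0).pos
  have hK' : (0 : ℝ) < K := by exact_mod_cast hK
  have hα0 : ∀ i, 0 ≤ α i := fun i => by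
    by_cases hi : i ∈ supportVectors hsep
    · exact (hαpos i hi).le
    · exact (hαzero i hi).ge
  set v : Fin N → EuclideanSpace ℝ (Fin d) := fun i => y i • x i with hv
  set A : Fin M → EuclideanSpace ℝ (Fin d) := fun k => ∑ i ∈ I k, α i • v i with hA
  have hAsum : ∑ k, A k = maxMarginSolution hsep := by
    have h1 : ∑ i, α i • v i = maxMarginSolution hsep := by
      rw [hαsum]
      refine (Finset.sum_subset (Finset.subset_univ _) fun i _ hi => ?_).symm.trans
        (Finset.sum_congr rfl fun i _ => (mul_smul _ _ _).symm)
      rw [hαzero i hi, zero_smul]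
    rw [← h1]
    have h2 : ∀ k, A k = ∑ i, if i ∈ I k then α i • v i else 0 := fun k => by
      rw [Finset.sum_ite_mem, Finset.univ_inter]
    simp only [h2]
    rw [Finset.sum_comm]
    refine Finset.sum_congr rfl fun i _ => ?_
    obtain ⟨k, hk, hk'⟩ := hI i
    rw [Finset.sum_eq_single k (fun l _ hl => if_neg fun hil => hl (hk' l hil))
      (fun h => absurd (Finset.mem_univ k) h), if_pos hk]
  -- the per-step target at time `t` is `aᵢ / t`, so that `K` steps on each of `M` tasks add up to
  -- `M / t • ŵ`
  set a : Fin N → ℝ := fun i => M * α i / K with ha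
  obtain ⟨wtilde, hwtilde⟩ := hnd.exists_inner_eq hsep fun i => Real.log (η / a i)
  obtain ⟨n, hn, ⟨B, hB⟩, hnsum⟩ := exists_taskOrder_corrector (A := A) hj
  refine hf.exists_norm_sub_log_smul_le (s := sigmaMax x ^ 2) (sq_nonneg _) (by positivity)
    (sigmaMax_sq_mul_lt_two hsep hN hy hη hβ hηlt) (v := v) ?_ (wtilde := wtilde) (a := a) ?_ ?_
    (J := fun t => I (j t))
    (w := seqGD η K (fun s => taskLoss x y ℓ (I (j s))) w₀) ?_ (fun t => rfl) hB hnsum ?_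
  · intro J D
    have h1 := norm_sum_smul_sq_le x fun i => if i ∈ J then D i * y i else 0
    have hy2 : ∀ i, y i ^ 2 = 1 := fun i => by rcases hy i with h | h <;> simp [h]
    simp only [ite_smul, zero_smul, ite_pow, mul_pow, hy2, mul_one, ne_eq, OfNat.ofNat_ne_zero,
      not_false_eq_true, zero_pow, Finset.sum_ite_mem, Finset.univ_inter, mul_smul] at h1
    exact h1
  · intro i
    have := hα0 i
    positivity
  · intro i
    rw [real_inner_smul_left]
    by_cases hi : i ∈ supportVectors hsep
    · left
      refine ⟨(mem_supportVectors_iff hsep hN).1 hi, ?_⟩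
      have hai : 0 < a i := by have := hαpos i hi; positivity
      rw [hwtilde i hi, Real.exp_neg, Real.exp_log (by positivity)]
      field_simp
    · right
      refine ⟨lt_of_le_of_ne (one_le_maxMarginSolution hsep i) fun h => hi ?_, ?_⟩
      · exact (mem_supportVectors_iff hsep hN).2 h.symm
      · simp [ha, hαzero i hi]
  · intro t k
    have hsucc : seqGD η K (fun s => taskLoss x y ℓ (I (j s))) w₀ t (k + 1) =
        seqGD η K (fun s => taskLoss x y ℓ (I (j s))) w₀ t k - η • gradient
          (taskLoss x y ℓ (I (j t))) (seqGD η K (fun s => taskLoss x y ℓ (I (j s))) w₀ t k) := rfl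
    rw [hsucc, gradient_taskLoss x y hℓ.differentiable, sub_eq_add_neg, Finset.smul_sum,
      ← Finset.sum_neg_distrib]
    congr 1
    exact Finset.sum_congr rfl fun i _ => by rw [smul_smul, neg_smul]
  · intro t ht
    rw [hn t ht, hAsum]
    congr 2
    rw [hA, Finset.smul_sum, Finset.smul_sum]
    refine Finset.sum_congr rfl fun i _ => ?_
    rw [smul_smul _ (α i) (v i), smul_smul _ (a i) (v i)]
    congr 1
    simp only [ha]
    field_simp

end ContinualGD

theorem theorem4p2 {d N M K : ℕ} (hN : 0 < N) (hK : 1 ≤ K)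
    (x : Fin N → EuclideanSpace ℝ (Fin d)) (y : Fin N → ℝ) (hy : ∀ i, y i = 1 ∨ y i = -1)
    (I : Fin M → Finset (Fin N)) (hI : ∀ i, ∃! j, i ∈ I j)
    (hsep : ContinualGD.JointlySeparable x y) (hnd : ContinualGD.NonDegenerate hsep)
    (ℓ : ℝ → ℝ) (β : ℝ) (hℓ : ContinualGD.LossShape ℓ β) (htail : ContinualGD.TightExpTail ℓ)
    (η : ℝ) (hη : 0 < η)
    (hηlt : η < 2 * ContinualGD.maxMargin hsep ^ 2 / (β * ContinualGD.sigmaMax x ^ 4))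
    {Ω : Type*} [MeasurableSpace Ω] (P : Measure Ω) [IsProbabilityMeasure P]
    (m : ℕ → Ω → Fin M) (hm : ContinualGD.IsUniformTaskOrder P m)
    (w₀ : EuclideanSpace ℝ (Fin d)) (w : ℕ → ℕ → Ω → EuclideanSpace ℝ (Fin d))
    (hw : ∀ t k ω, w t k ω =
      ContinualGD.seqGD η K (fun s => ContinualGD.taskLoss x y ℓ (I (m s ω))) w₀ t k) :
    ∀ᵐ ω ∂P,
      (∃ ρ : ℕ → ℕ → EuclideanSpace ℝ (Fin d),
        (∀ t, 1 ≤ t → ∀ k < K,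
          w t k ω = Real.log t • ContinualGD.maxMarginSolution hsep + ρ t k) ∧
        ∃ C : ℝ, ∀ t, 1 ≤ t → ∀ k < K, ‖ρ t k‖ ≤ C) ∧
      ∀ k < K, Tendsto (fun t => ‖w t k ω‖⁻¹ • w t k ω) atTop
        (𝓝 (‖ContinualGD.maxMarginSolution hsep‖⁻¹ • ContinualGD.maxMarginSolution hsep)) := by
  filter_upwards [hm.ae_summable] with ω hω
  obtain ⟨C, hC⟩ := ContinualGD.exists_norm_seqGD_sub_log_smul_le hN hK hy hI hsep hnd hℓ htail
    hη hηlt w₀ hω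
  simp only [← hw] at hC
  refine ⟨⟨fun t k => w t k ω - Real.log t • ContinualGD.maxMarginSolution hsep,
    fun t _ k _ => (add_sub_cancel _ _).symm, C, hC⟩, fun k hk => ?_⟩
  exact ContinualGD.tendsto_normalize_of_norm_sub_log_smul_le
    (ContinualGD.maxMarginSolution_ne_zero hsep hN) fun t ht => hC t ht k hk
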